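/- Let $d\ge 0$ be an integer, $\mathbb K$ a field, $\mathcal A$ a $\mathbb K$-algebra isomorphic to $\mathrm{Mat}_{d+1}(\mathbb K)$ (rows and columns indexed by $0,\dots,d$), $\mathrm{tr}$ the corresponding trace, and $V$ the irreducible left $\mathcal A$-module. An eigenvalue of $X\in\mathcal A$ is a root of its minimal polynomial, and $X$ is multiplicity-free if it has $d+1$ distinct eigenvalues, all in $\mathbb K$; the primitive idempotent of such an $X$ associated with its eigenvalue $\theta$ is $\prod_{\theta'\neq\theta}(X-\theta' I)/(\theta-\theta')$, the product over the other eigenvalues. Let $\Phi=(A;E_0,\dots,E_d;A^*;E^*_0,\dots,E^*_d)$ be a Leonard system in $\mathcal A$: $A,A^*\in\mathcal A$ are multiplicity-free; $E_0,\dots,E_d$ (resp. $E^*_0,\dots,E^*_d$) is an ordering of the primitive idempotents of $A$ (resp. $A^*$); and for $0\le i,j\le d$ both $E_iA^*E_j$ and $E^*_iAE^*_j$ are zero if $|i-j|>1$ and nonzero if $|i-j|=1$. Let $\theta_i$ (resp. $\theta^*_i$) be the eigenvalue of $A$ (resp. $A^*$) associated with $E_i$ (resp. $E^*_i$), and put $a_i=\mathrm{tr}(AE^*_i)$,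 $a^*_i=\mathrm{tr}(A^*E_i)$. For $1\le i\le d$ let $\varphi_i$ be the eigenvalue of $(A-\theta_{i-1}I)(A^*-\theta^*_iI)$ on the one-dimensional space $(E^*_0V+\cdots+E^*_iV)\cap(E_iV+\cdots+E_dV)$ (first split sequence), and let $\phi_1,\dots,\phi_d$ (second split sequence) be the first split sequence of the Leonard system $(A;E_d,\dots,E_0;A^*;E^*_0,\dots,E^*_d)$. Identify $S_4$ with the set of linear orderings $g=wxyz$ of the set $\Omega=\{0,d,0^*,d^*\}$ of four symbols; $0^*$ and $d^*$ are called starred. Fix nonzero vectors $\eta_0\in E_0V$, $\eta_d\in E_dV$, $\eta^*_0\in E^*_0V$, $\eta^*_d\in E^*_dV$. For $0\le n\le d$ write $$L_n=\prod_{h=0}^{n-1}(A-\theta_hI),\quad H_n=\prod_{h=n+1}^{d}(A-\theta_hI),\quad L^*_n=\prod_{h=0}^{n-1}(A^*-\theta^*_hI),\quad H^*_n=\prod_{h=n+1}^{d}(A^*-\theta^*_hI).$$ **Theorem.** For every $g\in S_4$ the vectors $v_0,\dots,v_d$ given in the tables below form a basis $[g]$ of $V$. Let $A^g$ and $A^{*g}$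 be the matrices representing $A$ and $A^*$ with respect to $[g]$, that is, $Xv_j=\sum_{i=0}^d X^g_{ij}v_i$ for $X\in\{A,A^*\}$. Their entries are as follows, where the $(i,i-1)$- and $(i-1,i)$-entries are for $1\le i\le d$, the $(i,i)$-entries are for $0\le i\le d$, and all entries not displayed are zero. Table 1. $$\begin{array}{c|c|ccc|ccc} g & v_i & A^g_{i,i-1} & A^g_{ii} & A^g_{i-1,i} & A^{*g}_{i,i-1} & A^{*g}_{ii} & A^{*g}_{i-1,i}\\ \hline d^*00^*d & L_i\eta^*_0 & 1&\theta_i&0&0&\theta^*_i&\varphi_i\\ 0d^*0^*d & H^*_i\eta_d & \varphi_i&\theta_i&0&0&\theta^*_i&1\\ d^*0d0^* & L_{d-i}\eta^*_0 & 0&\theta_{d-i}&1&\varphi_{d-i+1}&\theta^*_{d-i}&0\\ 0d^*d0^* & H^*_{d-i}\eta_d & 0&\theta_{d-i}&\varphi_{d-i+1}&1&\theta^*_{d-i}&0\\ \hline d0^*0d^* & L^*_i\eta_0 & 0&\theta_i&\varphi_i&1&\theta^*_i&0\\ 0^*d0d^* & H_i\eta^*_d & 0&\theta_i&1&\varphi_i&\theta^*_i&0\\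 d0^*d^*0 & L^*_{d-i}\eta_0 & \varphi_{d-i+1}&\theta_{d-i}&0&0&\theta^*_{d-i}&1\\ 0^*dd^*0 & H_{d-i}\eta^*_d & 1&\theta_{d-i}&0&0&\theta^*_{d-i}&\varphi_{d-i+1}\\ \hline dd^*00^* & H^*_{d-i}\eta_0 & 0&\theta_i&\phi_{d-i+1}&1&\theta^*_{d-i}&0\\ d^*d00^* & H_i\eta^*_0 & 0&\theta_i&1&\phi_{d-i+1}&\theta^*_{d-i}&0\\ dd^*0^*0 & H^*_i\eta_0 & \phi_i&\theta_{d-i}&0&0&\theta^*_i&1\\ d^*d0^*0 & H_{d-i}\eta^*_0 & 1&\theta_{d-i}&0&0&\theta^*_i&\phi_i\\ \hline 00^*dd^* & L^*_i\eta_d & 0&\theta_{d-i}&\phi_i&1&\theta^*_i&0\\ 0^*0dd^* & L_{d-i}\eta^*_d & 0&\theta_{d-i}&1&\phi_i&\theta^*_i&0\\ 00^*d^*d & L^*_{d-i}\eta_d & \phi_{d-i+1}&\theta_i&0&0&\theta^*_{d-i}&1\\ 0^*0d^*d & L_i\eta^*_d & 1&\theta_i&0&0&\theta^*_{d-i}&\phi_{d-i+1}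 \end{array}$$ For Tables 2 and 3 write $\beta_i=\prod_{h=0}^{i-1}(\theta_i-\theta_h)$, $\alpha_i=\prod_{h=i+1}^{d}(\theta_i-\theta_h)$, $\beta^*_i=\prod_{h=0}^{i-1}(\theta^*_i-\theta^*_h)$, $\alpha^*_i=\prod_{h=i+1}^{d}(\theta^*_i-\theta^*_h)$. Table 2 ($A^g$ diagonal). $$\begin{array}{c|c|c|ccc} g & v_i & A^g_{ii} & A^{*g}_{i,i-1} & A^{*g}_{ii} & A^{*g}_{i-1,i}\\ \hline d^*0^*0d & E_i\eta^*_0 & \theta_i & \phi_{d-i+1}\,\alpha_i/\alpha_{i-1} & a^*_i & \varphi_i\,\beta_{i-1}/\beta_i\\ 0^*d^*0d & E_i\eta^*_d & \theta_i & \varphi_i\,\alpha_i/\alpha_{i-1} & a^*_i & \phi_{d-i+1}\,\beta_{i-1}/\beta_i\\ d^*0^*d0 & E_{d-i}\eta^*_0 & \theta_{d-i} & \varphi_{d-i+1}\,\beta_{d-i}/\beta_{d-i+1} & a^*_{d-i} & \phi_i\,\alpha_{d-i+1}/\alpha_{d-i}\\ 0^*d^*d0 & E_{d-i}\eta^*_d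 & \theta_{d-i} & \phi_i\,\beta_{d-i}/\beta_{d-i+1} & a^*_{d-i} & \varphi_{d-i+1}\,\alpha_{d-i+1}/\alpha_{d-i} \end{array}$$ Table 3 ($A^{*g}$ diagonal). $$\begin{array}{c|c|ccc|c} g & v_i & A^g_{i,i-1} & A^g_{ii} & A^g_{i-1,i} & A^{*g}_{ii}\\ \hline d00^*d^* & E^*_i\eta_0 & \phi_i\,\alpha^*_i/\alpha^*_{i-1} & a_i & \varphi_i\,\beta^*_{i-1}/\beta^*_i & \theta^*_i\\ 0d0^*d^* & E^*_i\eta_d & \varphi_i\,\alpha^*_i/\alpha^*_{i-1} & a_i & \phi_i\,\beta^*_{i-1}/\beta^*_i & \theta^*_i\\ d0d^*0^* & E^*_{d-i}\eta_0 & \varphi_{d-i+1}\,\beta^*_{d-i}/\beta^*_{d-i+1} & a_{d-i} & \phi_{d-i+1}\,\alpha^*_{d-i+1}/\alpha^*_{d-i} & \theta^*_{d-i}\\ 0dd^*0^* & E^*_{d-i}\eta_d & \phi_{d-i+1}\,\beta^*_{d-i}/\beta^*_{d-i+1} & a_{d-i} & \varphi_{d-i+1}\,\alpha^*_{d-i+1}/\alpha^*_{d-i}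 & \theta^*_{d-i} \end{array}$$ Moreover, writing $g=wxyz$: if neither $y$ nor $z$ is starred, $A^g$ is diagonal and $A^{*g}$ is irreducible tridiagonal; if only $y$ is starred, $A^g$ is lower bidiagonal and $A^{*g}$ is upper bidiagonal; if only $z$ is starred, $A^g$ is upper bidiagonal and $A^{*g}$ is lower bidiagonal; if both are starred, $A^g$ is irreducible tridiagonal and $A^{*g}$ is diagonal. Here a tridiagonal matrix is irreducible if all entries immediately above and below the main diagonal are nonzero, and a matrix is lower (upper) bidiagonal if all its nonzero entries lie on or immediately below (above) the main diagonal. -/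

import Mathlib

noncomputable section

open Polynomial

/-- The set `Ω` of the four symbols `0, d, 0*, d*` (in this order). An element `wxyz` of `S₄`,
that is, a linear ordering of `Ω`, is an equivalence `g : Fin 4 ≃ Omega4` with
`w = g 0`, `x = g 1`, `y = g 2`, `z = g 3`. -/
inductive Omega4 : Type
  | z0
  | zd
  | s0
  | sd
  deriving DecidableEq

/-- The symbols `0*` and `d*` are starred, the symbols `0` and `d` are not. -/
def Omega4.Starred (w : Omega4) : Prop := w = Omega4.s0 ∨ w = Omega4.sd

/-- A sequence `f₀, …, f_d`, read at natural numbers (and `0` beyond `d`). -/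
def seqNat {M : Type*} [Zero M] {d : ℕ} (f : Fin (d + 1) → M) (n : ℕ) : M :=
  if h : n < d + 1 then f ⟨n, h⟩ else 0

/-- `A` is multiplicity-free, `θ₀, …, θ_d` is an ordering of its eigenvalues (the roots of its
minimal polynomial, which all lie in `K`), and `Eᵢ = ∏_{j ≠ i} (A - θⱼ) / (θᵢ - θⱼ)` is the
primitive idempotent of `A` associated with `θᵢ`. -/
structure IsPrimitiveIdempotents {K 𝒜 : Type*} [Field K] [Ring 𝒜] [Algebra K 𝒜] {d : ℕ}
    (A : 𝒜) (θ : Fin (d + 1) → K) (E : Fin (d + 1) → 𝒜) : Prop where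
  splits : (minpoly K A).Splits
  isRoot_iff : ∀ x : K, (minpoly K A).IsRoot x ↔ ∃ i, θ i = x
  injective : Function.Injective θ
  E_eq : ∀ i, E i = aeval A (∏ j ∈ Finset.univ.erase i, (C (θ i - θ j)⁻¹ * (X - C (θ j))))

theorem IsPrimitiveIdempotents.rev {K 𝒜 : Type*} [Field K] [Ring 𝒜] [Algebra K 𝒜] {d : ℕ}
    {A : 𝒜} {θ : Fin (d + 1) → K} {E : Fin (d + 1) → 𝒜} (h : IsPrimitiveIdempotents A θ E) :
    IsPrimitiveIdempotents A (fun i => θ i.rev) (fun i => E i.rev) where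
  splits := h.splits
  isRoot_iff x := by
    rw [h.isRoot_iff]
    exact ⟨fun ⟨i, hi⟩ => ⟨i.rev, by simpa using hi⟩, fun ⟨i, hi⟩ => ⟨i.rev, hi⟩⟩
  injective := h.injective.comp Fin.rev_injective
  E_eq i := by
    rw [h.E_eq]
    congr 1
    refine Finset.prod_bij' (fun j _ => j.rev) (fun j _ => j.rev) ?_ ?_ ?_ ?_ ?_
    · intro j hj
      simp only [Finset.mem_erase, Finset.mem_univ, and_true] at hj ⊢
      exact fun e => hj (by rw [← e, Fin.rev_rev])
    · intro j hj
      simp only [Finset.mem_erase, Finset.mem_univ, and_true] at hj ⊢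
      exact fun e => hj (Fin.rev_injective e)
    · simp
    · simp
    · simp

/-- A Leonard system `(A; E₀, …, E_d; A*; E*₀, …, E*_d)` of diameter `d` in the `K`-algebra `𝒜`
(which is to be isomorphic to `Mat_{d+1}(K)`). The star is written `s`. The eigenvalue `θᵢ` of `A`
associated with `Eᵢ`, and the eigenvalue `θ*ᵢ` of `A*` associated with `E*ᵢ`, are carried along;
they are determined by the rest. -/
structure LeonardSystem (K 𝒜 : Type*) [Field K] [Ring 𝒜] [Algebra K 𝒜] (d : ℕ) where
  A : 𝒜
  E : Fin (d + 1) → 𝒜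
  As : 𝒜
  Es : Fin (d + 1) → 𝒜
  θ : Fin (d + 1) → K
  θs : Fin (d + 1) → K
  primA : IsPrimitiveIdempotents A θ E
  primAs : IsPrimitiveIdempotents As θs Es
  E_far : ∀ i j : Fin (d + 1), 1 < |(i : ℤ) - (j : ℤ)| → E i * As * E j = 0
  E_near : ∀ i j : Fin (d + 1), |(i : ℤ) - (j : ℤ)| = 1 → E i * As * E j ≠ 0
  Es_far : ∀ i j : Fin (d + 1), 1 < |(i : ℤ) - (j : ℤ)| → Es i * A * Es j = 0
  Es_near : ∀ i j : Fin (d + 1), |(i : ℤ) - (j : ℤ)| = 1 → Es i * A * Es j ≠ 0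

theorem abs_rev_sub_rev {d : ℕ} (i j : Fin (d + 1)) :
    |((i.rev : Fin (d + 1)) : ℤ) - ((j.rev : Fin (d + 1)) : ℤ)| = |(i : ℤ) - (j : ℤ)| := by
  have hi : ((i.rev : Fin (d + 1)) : ℤ) = d - i := by
    have h1 := Fin.val_rev i
    have h2 := i.isLt
    omega
  have hj : ((j.rev : Fin (d + 1)) : ℤ) = d - j := by
    have h1 := Fin.val_rev j
    have h2 := j.isLt
    omega
  rw [hi, hj, abs_sub_comm]
  congr 1
  ring

/-- The matrix in `Mat_{d+1}(K)`, with rows and columns indexed by `0, …, d`, that has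
`(i, i-1)`-entry `lo i` and `(i-1, i)`-entry `up i` for `1 ≤ i ≤ d`, `(i, i)`-entry `di i` for
`0 ≤ i ≤ d`, and all other entries zero. -/
def triMat {K : Type*} [Zero K] {d : ℕ} (lo di up : ℕ → K) :
    Matrix (Fin (d + 1)) (Fin (d + 1)) K :=
  Matrix.of fun i j =>
    if (i : ℕ) = (j : ℕ) + 1 then lo i
    else if (i : ℕ) = (j : ℕ) then di i
    else if (j : ℕ) = (i : ℕ) + 1 then up j
    else 0

/-- Tridiagonal, with all entries immediately above and below the main diagonal nonzero. -/
def IsIrredTridiagonal {K : Type*} [Zero K] {d : ℕ}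
    (M : Matrix (Fin (d + 1)) (Fin (d + 1)) K) : Prop :=
  ∀ i j : Fin (d + 1), (1 < |(i : ℤ) - (j : ℤ)| → M i j = 0) ∧
    (|(i : ℤ) - (j : ℤ)| = 1 → M i j ≠ 0)

/-- Nonzero entries occur only on the main diagonal or immediately below it. -/
def IsLowerBidiagonal {K : Type*} [Zero K] {d : ℕ}
    (M : Matrix (Fin (d + 1)) (Fin (d + 1)) K) : Prop :=
  ∀ i j : Fin (d + 1), M i j ≠ 0 → (i : ℕ) = (j : ℕ) ∨ (i : ℕ) = (j : ℕ) + 1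

/-- Nonzero entries occur only on the main diagonal or immediately above it. -/
def IsUpperBidiagonal {K : Type*} [Zero K] {d : ℕ}
    (M : Matrix (Fin (d + 1)) (Fin (d + 1)) K) : Prop :=
  ∀ i j : Fin (d + 1), M i j ≠ 0 → (i : ℕ) = (j : ℕ) ∨ (j : ℕ) = (i : ℕ) + 1

/-- `(tᵢ - t₀)(tᵢ - t₁) ⋯ (tᵢ - tᵢ₋₁)`. -/
def prodBelow {K : Type*} [Field K] (t : ℕ → K) (i : ℕ) : K :=
  ∏ h ∈ Finset.range i, (t i - t h)

/-- `(tᵢ - t_d)(tᵢ - t_{d-1}) ⋯ (tᵢ - tᵢ₊₁)`. -/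
def prodAbove {K : Type*} [Field K] (d : ℕ) (t : ℕ → K) (i : ℕ) : K :=
  ∏ h ∈ Finset.Ioc i d, (t i - t h)

namespace LeonardSystem

variable {K 𝒜 : Type*} [Field K] [Ring 𝒜] [Algebra K 𝒜] {d : ℕ}

/-- The second inversion `(A; E_d, …, E₀; A*; E*₀, …, E*_d)` of `Φ`. -/
def secondInversion (Φ : LeonardSystem K 𝒜 d) : LeonardSystem K 𝒜 d where
  A := Φ.A
  E := fun i => Φ.E i.rev
  As := Φ.As
  Es := Φ.Es
  θ := fun i => Φ.θ i.rev
  θs := Φ.θs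
  primA := Φ.primA.rev
  primAs := Φ.primAs
  E_far i j h := Φ.E_far _ _ (by rw [abs_rev_sub_rev]; exact h)
  E_near i j h := Φ.E_near _ _ (by rw [abs_rev_sub_rev]; exact h)
  Es_far := Φ.Es_far
  Es_near := Φ.Es_near

section Module

variable (Φ : LeonardSystem K 𝒜 d) (V : Type*) [AddCommGroup V] [Module K V] [Module 𝒜 V]
  [IsScalarTower K 𝒜 V]

/-- The subspace `X V` of `V`, for `X` in `𝒜`. -/
def image (X : 𝒜) : Submodule K V := LinearMap.range (Algebra.lsmul K K V X)

/-- `Uᵢ = (E*₀V + ⋯ + E*ᵢV) ∩ (EᵢV + ⋯ + E_dV)`. -/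
def splitSpace (i : ℕ) : Submodule K V :=
  (⨆ j : Fin (d + 1), ⨆ _ : (j : ℕ) ≤ i, image V (Φ.Es j)) ⊓
    (⨆ j : Fin (d + 1), ⨆ _ : i ≤ (j : ℕ), image V (Φ.E j))

/-- The first split sequence: for `1 ≤ i ≤ d`, `φᵢ` is the eigenvalue of
`(A - θᵢ₋₁)(A* - θ*ᵢ)` on the (one-dimensional) space `Uᵢ`; `φ₀ = φ_{d+1} = 0`. -/
def firstSplit (i : ℕ) : K :=
  if 1 ≤ i ∧ i ≤ d then
    Classical.epsilon fun c : K => ∀ u ∈ Φ.splitSpace V i,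
      ((Φ.A - algebraMap K 𝒜 (seqNat Φ.θ (i - 1))) *
        (Φ.As - algebraMap K 𝒜 (seqNat Φ.θs i))) • u = c • u
  else 0

/-- The second split sequence: the first split sequence of the second inversion. -/
def secondSplit (i : ℕ) : K := Φ.secondInversion.firstSplit V i

end Module

/-- `(A - θ₀)(A - θ₁) ⋯ (A - θₙ₋₁)`. -/
def fromLow (A : 𝒜) (θ : Fin (d + 1) → K) (n : ℕ) : 𝒜 :=
  aeval A (∏ h ∈ Finset.range n, (X - C (seqNat θ h)))

/-- `(A - θ_d)(A - θ_{d-1}) ⋯ (A - θₙ₊₁)`. -/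
def fromHigh (A : 𝒜) (θ : Fin (d + 1) → K) (n : ℕ) : 𝒜 :=
  aeval A (∏ h ∈ Finset.Ioc n d, (X - C (seqNat θ h)))

/-- The vector `vᵢ` of the basis `[wxyz]` of `V`, built from the vectors
`η₀ = η z0`, `η_d = η zd`, `η*₀ = η s0`, `η*_d = η sd`. (The value is only used when `w, x, y, z`
are distinct.) -/
def basisVec (Φ : LeonardSystem K 𝒜 d) {V : Type*} [AddCommGroup V] [Module 𝒜 V]
    (η : Omega4 → V) (w x y z : Omega4) (i : ℕ) : V :=
  match w, x, y, z with
  | .sd, .z0, .s0, .zd => fromLow Φ.A Φ.θ i • η .s0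
  | .z0, .sd, .s0, .zd => fromHigh Φ.As Φ.θs i • η .zd
  | .sd, .z0, .zd, .s0 => fromLow Φ.A Φ.θ (d - i) • η .s0
  | .z0, .sd, .zd, .s0 => fromHigh Φ.As Φ.θs (d - i) • η .zd
  | .zd, .s0, .z0, .sd => fromLow Φ.As Φ.θs i • η .z0
  | .s0, .zd, .z0, .sd => fromHigh Φ.A Φ.θ i • η .sd
  | .zd, .s0, .sd, .z0 => fromLow Φ.As Φ.θs (d - i) • η .z0
  | .s0, .zd, .sd, .z0 => fromHigh Φ.A Φ.θ (d - i) • η .sd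
  | .zd, .sd, .z0, .s0 => fromHigh Φ.As Φ.θs (d - i) • η .z0
  | .sd, .zd, .z0, .s0 => fromHigh Φ.A Φ.θ i • η .s0
  | .zd, .sd, .s0, .z0 => fromHigh Φ.As Φ.θs i • η .z0
  | .sd, .zd, .s0, .z0 => fromHigh Φ.A Φ.θ (d - i) • η .s0
  | .z0, .s0, .zd, .sd => fromLow Φ.As Φ.θs i • η .zd
  | .s0, .z0, .zd, .sd => fromLow Φ.A Φ.θ (d - i) • η .sd
  | .z0, .s0, .sd, .zd => fromLow Φ.As Φ.θs (d - i) • η .zd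
  | .s0, .z0, .sd, .zd => fromLow Φ.A Φ.θ i • η .sd
  | .sd, .s0, .z0, .zd => seqNat Φ.E i • η .s0
  | .s0, .sd, .z0, .zd => seqNat Φ.E i • η .sd
  | .sd, .s0, .zd, .z0 => seqNat Φ.E (d - i) • η .s0
  | .s0, .sd, .zd, .z0 => seqNat Φ.E (d - i) • η .sd
  | .zd, .z0, .s0, .sd => seqNat Φ.Es i • η .z0
  | .z0, .zd, .s0, .sd => seqNat Φ.Es i • η .zd
  | .zd, .z0, .sd, .s0 => seqNat Φ.Es (d - i) • η .z0
  | .z0, .zd, .sd, .s0 => seqNat Φ.Es (d - i) • η .zd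
  | _, _, _, _ => 0

/-- `aᵢ = tr A E*ᵢ`, the trace being that of `Mat_{d+1}(K)`, to which `𝒜` is isomorphic by `σ`. -/
def a (Φ : LeonardSystem K 𝒜 d) (σ : 𝒜 ≃ₐ[K] Matrix (Fin (d + 1)) (Fin (d + 1)) K)
    (i : ℕ) : K := (σ (Φ.A * seqNat Φ.Es i)).trace

/-- `a*ᵢ = tr A* Eᵢ`. -/
def as (Φ : LeonardSystem K 𝒜 d) (σ : 𝒜 ≃ₐ[K] Matrix (Fin (d + 1)) (Fin (d + 1)) K)
    (i : ℕ) : K := (σ (Φ.As * seqNat Φ.E i)).trace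

/-- The table of the matrices: for `g = wxyz` the pair `(A^g, A*^g)` in terms of sequences `θ`,
`θs`, `a`, `as`, `φ`, `ψ` (`φ` is the first and `ψ` the second split sequence). Each matrix is
`triMat` of its `(i, i-1)`-, `(i, i)`- and `(i-1, i)`-entries. (The value is only used when
`w, x, y, z` are distinct.) -/
def matrixTable (d : ℕ) (θ θs a as φ ψ : ℕ → K) (w x y z : Omega4) :
    Matrix (Fin (d + 1)) (Fin (d + 1)) K × Matrix (Fin (d + 1)) (Fin (d + 1)) K :=
  match w, x, y, z with
  | .sd, .z0, .s0, .zd => (triMat 1 θ 0, triMat 0 θs φ)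
  | .z0, .sd, .s0, .zd => (triMat φ θ 0, triMat 0 θs 1)
  | .sd, .z0, .zd, .s0 =>
    (triMat 0 (fun i => θ (d - i)) 1, triMat (fun i => φ (d - i + 1)) (fun i => θs (d - i)) 0)
  | .z0, .sd, .zd, .s0 =>
    (triMat 0 (fun i => θ (d - i)) (fun i => φ (d - i + 1)), triMat 1 (fun i => θs (d - i)) 0)
  | .zd, .s0, .z0, .sd => (triMat 0 θ φ, triMat 1 θs 0)
  | .s0, .zd, .z0, .sd => (triMat 0 θ 1, triMat φ θs 0)
  | .zd, .s0, .sd, .z0 =>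
    (triMat (fun i => φ (d - i + 1)) (fun i => θ (d - i)) 0, triMat 0 (fun i => θs (d - i)) 1)
  | .s0, .zd, .sd, .z0 =>
    (triMat 1 (fun i => θ (d - i)) 0, triMat 0 (fun i => θs (d - i)) (fun i => φ (d - i + 1)))
  | .zd, .sd, .z0, .s0 =>
    (triMat 0 θ (fun i => ψ (d - i + 1)), triMat 1 (fun i => θs (d - i)) 0)
  | .sd, .zd, .z0, .s0 =>
    (triMat 0 θ 1, triMat (fun i => ψ (d - i + 1)) (fun i => θs (d - i)) 0)
  | .zd, .sd, .s0, .z0 => (triMat ψ (fun i => θ (d - i)) 0, triMat 0 θs 1)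
  | .sd, .zd, .s0, .z0 => (triMat 1 (fun i => θ (d - i)) 0, triMat 0 θs ψ)
  | .z0, .s0, .zd, .sd => (triMat 0 (fun i => θ (d - i)) ψ, triMat 1 θs 0)
  | .s0, .z0, .zd, .sd => (triMat 0 (fun i => θ (d - i)) 1, triMat ψ θs 0)
  | .z0, .s0, .sd, .zd =>
    (triMat (fun i => ψ (d - i + 1)) θ 0, triMat 0 (fun i => θs (d - i)) 1)
  | .s0, .z0, .sd, .zd =>
    (triMat 1 θ 0, triMat 0 (fun i => θs (d - i)) (fun i => ψ (d - i + 1)))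
  | .sd, .s0, .z0, .zd =>
    (triMat 0 θ 0,
      triMat (fun i => ψ (d - i + 1) * (prodAbove d θ i / prodAbove d θ (i - 1)))
        as
        (fun i => φ i * (prodBelow θ (i - 1) / prodBelow θ i)))
  | .s0, .sd, .z0, .zd =>
    (triMat 0 θ 0,
      triMat (fun i => φ i * (prodAbove d θ i / prodAbove d θ (i - 1)))
        as
        (fun i => ψ (d - i + 1) * (prodBelow θ (i - 1) / prodBelow θ i)))
  | .sd, .s0, .zd, .z0 =>
    (triMat 0 (fun i => θ (d - i)) 0,
      triMat (fun i => φ (d - i + 1) * (prodBelow θ (d - i) / prodBelow θ (d - i + 1)))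
        (fun i => as (d - i))
        (fun i => ψ i * (prodAbove d θ (d - i + 1) / prodAbove d θ (d - i))))
  | .s0, .sd, .zd, .z0 =>
    (triMat 0 (fun i => θ (d - i)) 0,
      triMat (fun i => ψ i * (prodBelow θ (d - i) / prodBelow θ (d - i + 1)))
        (fun i => as (d - i))
        (fun i => φ (d - i + 1) * (prodAbove d θ (d - i + 1) / prodAbove d θ (d - i))))
  | .zd, .z0, .s0, .sd =>
    (triMat (fun i => ψ i * (prodAbove d θs i / prodAbove d θs (i - 1)))
        a
        (fun i => φ i * (prodBelow θs (i - 1) / prodBelow θs i)),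
      triMat 0 θs 0)
  | .z0, .zd, .s0, .sd =>
    (triMat (fun i => φ i * (prodAbove d θs i / prodAbove d θs (i - 1)))
        a
        (fun i => ψ i * (prodBelow θs (i - 1) / prodBelow θs i)),
      triMat 0 θs 0)
  | .zd, .z0, .sd, .s0 =>
    (triMat (fun i => φ (d - i + 1) * (prodBelow θs (d - i) / prodBelow θs (d - i + 1)))
        (fun i => a (d - i))
        (fun i => ψ (d - i + 1) * (prodAbove d θs (d - i + 1) / prodAbove d θs (d - i))),
      triMat 0 (fun i => θs (d - i)) 0)
  | .z0, .zd, .sd, .s0 =>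
    (triMat (fun i => ψ (d - i + 1) * (prodBelow θs (d - i) / prodBelow θs (d - i + 1)))
        (fun i => a (d - i))
        (fun i => φ (d - i + 1) * (prodAbove d θs (d - i + 1) / prodAbove d θs (d - i))),
      triMat 0 (fun i => θs (d - i)) 0)
  | _, _, _, _ => (0, 0)

end LeonardSystem

end

/-! By simplicity `V` is the module of columns, so `𝒜` acts faithfully on a space of dimension `d +
1`. There `A` and `A*` have eigenbases `e` and `f`, and each operator is irreducible tridiagonal in
the eigenbasis of the other. Put `v_n = (A - θ_0) ⋯ (A - θ_{n-1}) f_0`. In `f`-coordinates `v_n` is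
supported on `0, …, n` with nonzero last coordinate; in `e`-coordinates it is supported on `n, …, d`
with nonzero first coordinate. Two such flags meet in a line, so `v_n` spans the split space `U_n`.
For `n ≥ 1` the same support count puts `(A* - θ*_n) v_n` into `U_{n-1}`. Thus the `v_n` form a
split basis: `A` is lower bidiagonal with ones, and `A*` is upper bidiagonal with the first split
sequence above the diagonal (`LeonardSystem.isSplitBasis`).

One split basis yields three more. Reversing and rescaling it exchanges the two operators
(`IsSplitBasis.swap`). An irreducible tridiagonal matrix can be symmetrized, so `A` and `A*` are
both self-adjoint for some nondegenerate form, and the reversed dual basis is split with all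
parameter sequences reversed (`IsSplitBasis.exists_dual`). A split basis is determined by its first
vector, which spans a simple eigenspace, so it can be made to start at a prescribed eigenvector
(`IsSplitBasis.normalize`). Applied to the system and to its second inversion, this gives eight
bases; reversing their order gives the sixteen of Table 1.

For Tables 2 and 3, scale the eigenbasis of one operator so that a given extremal eigenvector `x` of
the other has all coordinates `1`. The split vectors starting at `x` then have products of
eigenvalue differences as coordinates, and one coordinate of the bidiagonal relation gives the
superdiagonal (`IsSplitBasis.superdiag`). The split basis that starts at the same `x` with the
eigenvalues in the opposite order gives the subdiagonal. The diagonal does not depend on the scaling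
and consists of traces. -/

noncomputable section

open Polynomial

/-! ### Split bases. -/

section LinearAlgebra

variable {K V : Type*} [Field K] [AddCommGroup V] [Module K V] {d : ℕ}

/-- The vectors `x, (X - ξ₀) x, (X - ξ₁) (X - ξ₀) x, …`. -/
def lowVec (X : Module.End K V) (ξ : ℕ → K) (x : V) : ℕ → V
  | 0 => x
  | n + 1 => X (lowVec X ξ x n) - ξ n • lowVec X ξ x n

theorem lowVec_eq_aeval (X : Module.End K V) (ξ : ℕ → K) (x : V) (n : ℕ) :
    lowVec X ξ x n = aeval X (∏ h ∈ Finset.range n, (Polynomial.X - C (ξ h))) x := by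
  induction n with
  | zero => simp [lowVec]
  | succ n ih =>
    rw [Finset.prod_range_succ, mul_comm, map_mul, Module.End.mul_apply, ← ih]
    simp [lowVec, Module.algebraMap_end_apply]

theorem lowVec_smul (X : Module.End K V) (ξ : ℕ → K) (c : K) (x : V) (n : ℕ) :
    lowVec X ξ (c • x) n = c • lowVec X ξ x n := by
  simp [lowVec_eq_aeval]

/-- In the basis `v₀, …, v_d` the endomorphism `X` is lower bidiagonal with diagonal `ξ` and
subdiagonal entries `1`, and `Y` is upper bidiagonal with diagonal `ζ` and superdiagonal `φ`. -/
structure IsSplitBasis (d : ℕ) (X Y : Module.End K V) (ξ ζ φ : ℕ → K) (v : ℕ → V) : Prop where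
  linearIndependent : LinearIndependent K fun i : Fin (d + 1) => v i
  ne_zero : ∀ j < d, φ (j + 1) ≠ 0
  lower : ∀ j < d, X (v j) = v (j + 1) + ξ j • v j
  lower_last : X (v d) = ξ d • v d
  upper_zero : Y (v 0) = ζ 0 • v 0
  upper : ∀ j < d, Y (v (j + 1)) = ζ (j + 1) • v (j + 1) + φ (j + 1) • v j

/-- `x` is an eigenvector of `X`, and spans the eigenspace for the eigenvalue `c`. -/
structure IsSimpleEigenvector (X : Module.End K V) (c : K) (x : V) : Prop where
  ne_zero : x ≠ 0
  apply_eq : X x = c • x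
  eq_smul : ∀ u, X u = c • u → ∃ a : K, u = a • x

namespace IsSplitBasis

variable {X Y : Module.End K V} {ξ ζ φ : ℕ → K} {v : ℕ → V}

theorem congr {ξ' ζ' φ' : ℕ → K} (h : IsSplitBasis d X Y ξ ζ φ v)
    (hξ : ∀ i ≤ d, ξ i = ξ' i) (hζ : ∀ i ≤ d, ζ i = ζ' i) (hφ : ∀ i < d, φ (i + 1) = φ' (i + 1)) :
    IsSplitBasis d X Y ξ' ζ' φ' v where
  linearIndependent := h.linearIndependent
  ne_zero j hj := by rw [← hφ j hj]; exact h.ne_zero j hj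
  lower j hj := by rw [← hξ j hj.le]; exact h.lower j hj
  lower_last := by rw [← hξ d le_rfl]; exact h.lower_last
  upper_zero := by rw [← hζ 0 (Nat.zero_le _)]; exact h.upper_zero
  upper j hj := by rw [← hζ _ hj, ← hφ j hj]; exact h.upper j hj

theorem lowVec_eq (h : IsSplitBasis d X Y ξ ζ φ v) {n : ℕ} (hn : n ≤ d) :
    lowVec X ξ (v 0) n = v n := by
  induction n with
  | zero => rfl
  | succ n ih => rw [lowVec, ih (by omega), h.lower n hn]; abel

/-- Rescaling the vectors and reversing their order exchanges the roles of `X` and `Y`. -/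
theorem swap (h : IsSplitBasis d X Y ξ ζ φ v) :
    IsSplitBasis d Y X (fun i => ζ (d - i)) (fun i => ξ (d - i)) (fun i => φ (d - i + 1))
      (fun i => (∏ k ∈ Finset.Ico (d - i) d, φ (k + 1)) • v (d - i)) where
  linearIndependent := by
    have h1 := h.linearIndependent.comp Fin.rev Fin.rev_injective
    have h2 := h1.units_smul (fun i : Fin (d + 1) =>
      Units.mk0 (∏ k ∈ Finset.Ico (d - (i : ℕ)) d, φ (k + 1))
        (Finset.prod_ne_zero_iff.2 fun k hk => h.ne_zero k (Finset.mem_Ico.1 hk).2))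
    convert h2 using 2 with i
    simp only [Pi.smul_apply', Function.comp_apply, Units.smul_def, Units.val_mk0]
    congr 2
    rw [Fin.val_rev]; omega
  ne_zero j hj := h.ne_zero _ (by omega)
  lower j hj := by
    -- With `m = d - (j + 1)`, the scalar in front of `v m` has one factor `φ (m + 1)` more than
    -- that of `v (m + 1)`. This factor normalizes the coefficient in `Y` to `1` and moves `φ (m +
    -- 1)` into `X`.
    obtain ⟨m, rfl⟩ : ∃ m, d = j + 1 + m := ⟨d - (j + 1), by omega⟩
    have e1 : j + 1 + m - j = m + 1 := by omega
    have e2 : j + 1 + m - (j + 1) = m := by omega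
    simp only [e1, e2, map_smul]
    rw [h.upper m (by omega), Finset.prod_eq_prod_Ico_succ_bot (show m < j + 1 + m by omega)]
    module
  lower_last := by
    simp only [Nat.sub_self, map_smul, h.upper_zero]
    exact smul_comm _ _ _
  upper_zero := by simp [h.lower_last]
  upper j hj := by
    obtain ⟨m, rfl⟩ : ∃ m, d = j + 1 + m := ⟨d - (j + 1), by omega⟩
    have e1 : j + 1 + m - j = m + 1 := by omega
    have e2 : j + 1 + m - (j + 1) = m := by omega
    simp only [e1, e2, map_smul]
    rw [h.lower m (by omega), Finset.prod_eq_prod_Ico_succ_bot (show m < j + 1 + m by omega)]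
    module

theorem card_eq (_ : IsSplitBasis d X Y ξ ζ φ v) (hV : Module.finrank K V = d + 1) :
    Fintype.card (Fin (d + 1)) = Module.finrank K V := by simp [hV]

/-- The basis formed by `v₀, …, v_d`. -/
def basis (h : IsSplitBasis d X Y ξ ζ φ v) (hV : Module.finrank K V = d + 1) :
    Module.Basis (Fin (d + 1)) K V :=
  basisOfLinearIndependentOfCardEqFinrank h.linearIndependent (h.card_eq hV)

theorem basis_apply (h : IsSplitBasis d X Y ξ ζ φ v) (hV : Module.finrank K V = d + 1)
    (i : Fin (d + 1)) : h.basis hV i = v i := by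
  simp [basis]

theorem smul (h : IsSplitBasis d X Y ξ ζ φ v) {c : K} (hc : c ≠ 0) :
    IsSplitBasis d X Y ξ ζ φ (fun i => c • v i) where
  linearIndependent := by
    have h2 := h.linearIndependent.units_smul (fun _ : Fin (d + 1) => Units.mk0 c hc)
    exact h2
  ne_zero := h.ne_zero
  lower j hj := by rw [map_smul, h.lower j hj]; module
  lower_last := by rw [map_smul, h.lower_last]; module
  upper_zero := by rw [map_smul, h.upper_zero]; module
  upper j hj := by rw [map_smul, h.upper j hj]; module

/-- The vectors of a split basis are determined by any eigenvector of `Y` for the eigenvalue `ζ₀`,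
if this eigenvalue is simple. -/
theorem normalize (h : IsSplitBasis d X Y ξ ζ φ v) {x : V} (hx : IsSimpleEigenvector Y (ζ 0) x) :
    IsSplitBasis d X Y ξ ζ φ (lowVec X ξ x) := by
  have hv0 : v 0 ≠ 0 := h.linearIndependent.ne_zero (0 : Fin (d + 1))
  obtain ⟨a, ha⟩ := hx.eq_smul _ h.upper_zero
  have ha0 : a ≠ 0 := by rintro rfl; exact hv0 (by rw [ha, zero_smul])
  have hc : a⁻¹ ≠ 0 := inv_ne_zero ha0
  have hy : x = a⁻¹ • v 0 := by rw [ha, inv_smul_smul₀ ha0]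
  have key : ∀ n ≤ d, a⁻¹ • v n = lowVec X ξ x n := by
    intro n hn
    rw [hy, lowVec_smul, h.lowVec_eq hn]
  have h' := h.smul hc
  refine ⟨?_, h.ne_zero, ?_, ?_, ?_, ?_⟩
  · convert h'.linearIndependent using 2 with i
    exact (key i (by omega)).symm
  · intro j hj; rw [← key j hj.le, ← key (j + 1) hj]; exact h'.lower j hj
  · rw [← key d le_rfl]; exact h'.lower_last
  · rw [← key 0 (Nat.zero_le _)]; exact h'.upper_zero
  · intro j hj; rw [← key j hj.le, ← key (j + 1) hj]; exact h'.upper j hj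

end IsSplitBasis

/-! ### Coordinates of vectors, Leonard pairs, and the split basis of a Leonard pair. -/

theorem repr_apply_of_eigenbasis {ι : Type*} [Fintype ι] [DecidableEq ι]
    (e : Module.Basis ι K V) {A : Module.End K V} {θ : ι → K} (hA : ∀ i, A (e i) = θ i • e i)
    (x : V) (k : ι) : e.repr (A x) k = θ k * e.repr x k := by
  have h : e.coord k ∘ₗ A = θ k • e.coord k := e.ext fun i => by
    by_cases hik : i = k <;> simp [hA, hik]
  exact LinearMap.congr_fun h x

theorem repr_apply_eq_sum {ι : Type*} [Fintype ι] [DecidableEq ι]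
    (e : Module.Basis ι K V) (A : Module.End K V) (x : V) (k : ι) :
    e.repr (A x) k = ∑ j, LinearMap.toMatrix e e A k j * e.repr x j := by
  rw [← LinearMap.toMatrix_mulVec_repr e e A x]; rfl

/-- A tridiagonal map extends the support of a coordinate vector by at most one place on either
side. This lemma and the next three record that and the value in the new place, where a single term
of the matrix product survives. -/
theorem repr_apply_eq_zero_of_above (f : Module.Basis (Fin (d + 1)) K V) {A : Module.End K V}
    (hf : IsIrredTridiagonal (LinearMap.toMatrix f f A)) {x : V} {n : ℕ}
    (hx : ∀ k : Fin (d + 1), n < k → f.repr x k = 0) {k : Fin (d + 1)} (hk : n + 1 < k) :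
    f.repr (A x) k = 0 := by
  rw [repr_apply_eq_sum]
  refine Finset.sum_eq_zero fun j _ => ?_
  by_cases hj : n < (j : ℕ)
  · rw [hx j hj, mul_zero]
  · rw [(hf k j).1 (by rw [lt_abs]; omega), zero_mul]

theorem repr_apply_eq_of_above (f : Module.Basis (Fin (d + 1)) K V) {A : Module.End K V}
    (hf : IsIrredTridiagonal (LinearMap.toMatrix f f A)) {x : V} {m k : Fin (d + 1)}
    (hx : ∀ k : Fin (d + 1), m < k → f.repr x k = 0) (hk : (k : ℕ) = m + 1) :
    f.repr (A x) k = LinearMap.toMatrix f f A k m * f.repr x m := by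
  rw [repr_apply_eq_sum]
  refine Finset.sum_eq_single m (fun j _ hjm => ?_) (by simp)
  by_cases hj : m < j
  · rw [hx j hj, mul_zero]
  · rw [(hf k j).1 (by rw [lt_abs]; omega), zero_mul]

theorem repr_apply_eq_zero_of_below (f : Module.Basis (Fin (d + 1)) K V) {A : Module.End K V}
    (hf : IsIrredTridiagonal (LinearMap.toMatrix f f A)) {x : V} {n : ℕ}
    (hx : ∀ k : Fin (d + 1), (k : ℕ) < n → f.repr x k = 0) {k : Fin (d + 1)} (hk : (k : ℕ) + 1 < n) :
    f.repr (A x) k = 0 := by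
  rw [repr_apply_eq_sum]
  refine Finset.sum_eq_zero fun j _ => ?_
  by_cases hj : (j : ℕ) < n
  · rw [hx j hj, mul_zero]
  · rw [(hf k j).1 (by rw [lt_abs]; omega), zero_mul]

theorem repr_apply_eq_of_below (f : Module.Basis (Fin (d + 1)) K V) {A : Module.End K V}
    (hf : IsIrredTridiagonal (LinearMap.toMatrix f f A)) {x : V} {m k : Fin (d + 1)}
    (hx : ∀ k : Fin (d + 1), k < m → f.repr x k = 0) (hk : (m : ℕ) = k + 1) :
    f.repr (A x) k = LinearMap.toMatrix f f A k m * f.repr x m := by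
  rw [repr_apply_eq_sum]
  refine Finset.sum_eq_single m (fun j _ hjm => ?_) (by simp)
  by_cases hj : j < m
  · rw [hx j hj, mul_zero]
  · rw [(hf k j).1 (by rw [lt_abs]; omega), zero_mul]

theorem repr_lowVec (e : Module.Basis (Fin (d + 1)) K V) {A : Module.End K V} {θ : ℕ → K}
    (hA : ∀ i : Fin (d + 1), A (e i) = θ i • e i) (x : V) (k : Fin (d + 1)) (n : ℕ) :
    e.repr (lowVec A θ x n) k = (∏ h ∈ Finset.range n, (θ k - θ h)) * e.repr x k := by
  induction n with
  | zero => simp [lowVec]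
  | succ n ih =>
    rw [lowVec, map_sub, map_smul, Finsupp.sub_apply, Finsupp.smul_apply,
      repr_apply_of_eigenbasis e (θ := fun i => θ i) hA, ih, Finset.prod_range_succ, smul_eq_mul]
    ring

/-- A pair of endomorphisms with eigenbases `e` and `f`, each acting on the eigenbasis of the other
in an irreducible tridiagonal fashion. -/
structure IsLeonardPair (A B : Module.End K V) (θ τ : ℕ → K)
    (e f : Module.Basis (Fin (d + 1)) K V) : Prop where
  eigenA : ∀ i : Fin (d + 1), A (e i) = θ i • e i
  eigenB : ∀ i : Fin (d + 1), B (f i) = τ i • f i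
  injA : ∀ i j : Fin (d + 1), θ i = θ j → i = j
  injB : ∀ i j : Fin (d + 1), τ i = τ j → i = j
  tridiagA : IsIrredTridiagonal (LinearMap.toMatrix f f A)
  tridiagB : IsIrredTridiagonal (LinearMap.toMatrix e e B)

namespace IsLeonardPair

variable {A B : Module.End K V} {θ τ : ℕ → K} {e f : Module.Basis (Fin (d + 1)) K V}

theorem repr_lowVec_above (h : IsLeonardPair A B θ τ e f) (n : ℕ) (k : Fin (d + 1)) (hk : n < k) :
    f.repr (lowVec A θ (f 0) n) k = 0 := by
  induction n generalizing k with
  | zero =>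
    have : (0 : Fin (d + 1)) ≠ k := fun hh => by simp [← hh] at hk
    simp [lowVec, this]
  | succ n ih =>
    rw [lowVec, map_sub, map_smul, Finsupp.sub_apply, Finsupp.smul_apply, ih k (by omega),
      repr_apply_eq_zero_of_above f h.tridiagA ih hk]
    simp

/-- Each step multiplies the leading coordinate by a subdiagonal entry of `A`, which is nonzero by
irreducibility. -/
theorem repr_lowVec_self (h : IsLeonardPair A B θ τ e f) (n : ℕ) (hn : n < d + 1) :
    f.repr (lowVec A θ (f 0) n) ⟨n, hn⟩ ≠ 0 := by
  induction n with
  | zero => simp [lowVec]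
  | succ n ih =>
    have h0 := h.repr_lowVec_above n ⟨n + 1, hn⟩ (by simp)
    rw [lowVec, map_sub, map_smul, Finsupp.sub_apply, Finsupp.smul_apply, h0, smul_zero, sub_zero,
      repr_apply_eq_of_above f h.tridiagA (m := ⟨n, by omega⟩)
        (fun k hk => h.repr_lowVec_above n k hk) rfl]
    exact mul_ne_zero ((h.tridiagA _ _).2 (by simp)) (ih _)

/-- The coordinate matrix with respect to `f` is triangular with nonzero diagonal. -/
theorem linearIndependent_lowVec (h : IsLeonardPair A B θ τ e f) :
    LinearIndependent K fun i : Fin (d + 1) => lowVec A θ (f 0) i := by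
  have hdet : IsUnit (f.det fun i : Fin (d + 1) => lowVec A θ (f 0) i) := by
    rw [Module.Basis.det_apply, Matrix.det_of_isUpperTriangular, isUnit_iff_ne_zero,
      Finset.prod_ne_zero_iff]
    · intro i _
      exact h.repr_lowVec_self i i.2
    · intro i j hij
      exact h.repr_lowVec_above j i hij
  exact ((Module.Basis.is_basis_iff_det f).2 hdet).1

theorem span_lowVec (h : IsLeonardPair A B θ τ e f) :
    Submodule.span K (Set.range fun i : Fin (d + 1) => lowVec A θ (f 0) i) = ⊤ := by
  have : Module.Finite K V := Module.Finite.of_basis f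
  exact h.linearIndependent_lowVec.span_eq_top_of_card_eq_finrank
    (Module.finrank_eq_card_basis f).symm

/-- If one `e`-coordinate of `f 0` vanished, it would vanish on every `lowVec`, because `A` is
diagonal in `e`; but these vectors span. -/
theorem repr_zero_ne_zero (h : IsLeonardPair A B θ τ e f) (k : Fin (d + 1)) :
    e.repr (f 0) k ≠ 0 := by
  intro h0
  have h1 : e.coord k = 0 := by
    refine LinearMap.ext_on_range h.span_lowVec fun i => ?_
    simp [Module.Basis.coord_apply, repr_lowVec e h.eigenA, h0]
  have h2 := LinearMap.congr_fun h1 (e k)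
  simp at h2

theorem repr_lowVec_below (h : IsLeonardPair A B θ τ e f) (n : ℕ) (k : Fin (d + 1))
    (hk : (k : ℕ) < n) : e.repr (lowVec A θ (f 0) n) k = 0 := by
  rw [repr_lowVec e h.eigenA, Finset.prod_eq_zero (Finset.mem_range.2 hk) (sub_self _), zero_mul]

theorem repr_lowVec_diag (h : IsLeonardPair A B θ τ e f) (k : Fin (d + 1)) :
    e.repr (lowVec A θ (f 0) k) k ≠ 0 := by
  rw [repr_lowVec e h.eigenA]
  refine mul_ne_zero (Finset.prod_ne_zero_iff.2 fun i hi => ?_) (h.repr_zero_ne_zero k)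
  have hi' := Finset.mem_range.1 hi
  intro h0
  have := h.injA k ⟨i, by omega⟩ (sub_eq_zero.1 h0)
  rw [this] at hi'
  simp at hi'

/-- The flags of `f` and of `e` are in opposite position. Subtracting a multiple of `lowVec` removes
the top `f`-coordinate without disturbing the vanishing `e`-coordinates, so induction makes `x` that
multiple; its next `e`-coordinate then forces the scalar to be zero. -/
theorem eq_zero_of_repr (h : IsLeonardPair A B θ τ e f) {m : ℕ} (hm : m ≤ d + 1) {x : V}
    (hf : ∀ k : Fin (d + 1), m ≤ k → f.repr x k = 0)
    (he : ∀ k : Fin (d + 1), (k : ℕ) < m → e.repr x k = 0) : x = 0 := by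
  induction m generalizing x with
  | zero => exact f.ext_elem fun k => by simpa using hf k (Nat.zero_le _)
  | succ m ih =>
    set i : Fin (d + 1) := ⟨m, by omega⟩ with hi
    set v := lowVec A θ (f 0) m with hv
    have hvf : f.repr v i ≠ 0 := h.repr_lowVec_self m i.2
    have hve : e.repr v i ≠ 0 := h.repr_lowVec_diag i
    set c := f.repr x i / f.repr v i with hc
    have hx : x - c • v = 0 := by
      refine ih (by omega) (fun k hk => ?_) fun k hk => ?_
      · rcases hk.lt_or_eq with hk | hk
        · simp [hf k hk, hv, h.repr_lowVec_above m k hk]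
        · obtain rfl : i = k := Fin.ext hk
          simp [hc, div_mul_cancel₀ _ hvf]
      · simp [he k (by omega), hv, h.repr_lowVec_below m k hk]
    have hx' : x = c • v := sub_eq_zero.1 hx
    have h1 := he i (by simp [hi])
    rw [hx', map_smul, Finsupp.smul_apply, smul_eq_mul] at h1
    rw [hx', (mul_eq_zero.1 h1).resolve_right hve, zero_smul]

/-- The coordinate form of the fact that the split space `U_m` is one-dimensional. -/
theorem eq_smul_of_repr (h : IsLeonardPair A B θ τ e f) {m : ℕ} (hm : m ≤ d) {x : V}
    (hf : ∀ k : Fin (d + 1), m < k → f.repr x k = 0)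
    (he : ∀ k : Fin (d + 1), (k : ℕ) < m → e.repr x k = 0) :
    ∃ c : K, x = c • lowVec A θ (f 0) m := by
  set i : Fin (d + 1) := ⟨m, by omega⟩ with hi
  set v := lowVec A θ (f 0) m with hv
  have hvf : f.repr v i ≠ 0 := h.repr_lowVec_self m i.2
  refine ⟨f.repr x i / f.repr v i, sub_eq_zero.1 (h.eq_zero_of_repr (m := m) (by omega)
    (fun k hk => ?_) fun k hk => ?_)⟩
  · rcases hk.lt_or_eq with hk | hk
    · simp [hf k hk, hv, h.repr_lowVec_above m k hk]
    · obtain rfl : i = k := Fin.ext hk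
      simp [div_mul_cancel₀ _ hvf]
  · simp [he k (by omega), hv, h.repr_lowVec_below m k hk]

/-- Subtracting `τ (j + 1)` kills the top `f`-coordinate, and tridiagonality of `B` in `e` lowers
the `e`-support by at most one. So the image lies in the line `U_j`. -/
theorem exists_apply_lowVec (h : IsLeonardPair A B θ τ e f) {j : ℕ} (hj : j < d) :
    ∃ c : K, B (lowVec A θ (f 0) (j + 1)) =
      τ (j + 1) • lowVec A θ (f 0) (j + 1) + c • lowVec A θ (f 0) j := by
  set v := lowVec A θ (f 0) (j + 1) with hv
  obtain ⟨c, hc⟩ := h.eq_smul_of_repr (m := j) (x := B v - τ (j + 1) • v) hj.le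
    (fun k hk => by
      rw [map_sub, map_smul, Finsupp.sub_apply, Finsupp.smul_apply,
        repr_apply_of_eigenbasis f (θ := fun i => τ i) h.eigenB, smul_eq_mul, ← sub_mul]
      rcases (Nat.succ_le_of_lt hk).lt_or_eq with hk | hk
      · rw [hv, h.repr_lowVec_above _ k hk, mul_zero]
      · rw [← hk]; simp)
    (fun k hk => by
      rw [map_sub, map_smul, Finsupp.sub_apply, Finsupp.smul_apply,
        h.repr_lowVec_below _ k (by omega), repr_apply_eq_zero_of_below e h.tridiagB
          (n := j + 1) (fun i hi => h.repr_lowVec_below _ i hi) (by omega)]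
      simp)
  exact ⟨c, by rw [← hc]; abel⟩

/-- The coefficients `φ` of the split form are nonzero. -/
theorem ne_zero_of_apply_lowVec (h : IsLeonardPair A B θ τ e f) {j : ℕ} (hj : j < d) {c : K}
    (hc : B (lowVec A θ (f 0) (j + 1)) =
      τ (j + 1) • lowVec A θ (f 0) (j + 1) + c • lowVec A θ (f 0) j) : c ≠ 0 := by
  rintro rfl
  rw [zero_smul, add_zero] at hc
  -- On the left the `e`-coordinate at `j` is a superdiagonal entry of `B` times the first nonzero
  -- coordinate; on the right it is zero.
  have h1 := congrArg (fun x => e.repr x ⟨j, by omega⟩) hc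
  simp only [map_smul, Finsupp.smul_apply] at h1
  rw [h.repr_lowVec_below _ _ (by simp), smul_zero,
    repr_apply_eq_of_below e h.tridiagB (m := ⟨j + 1, by omega⟩)
      (fun k hk => h.repr_lowVec_below _ _ hk) rfl] at h1
  exact mul_ne_zero ((h.tridiagB _ _).2 (by simp)) (h.repr_lowVec_diag ⟨j + 1, by omega⟩) h1

theorem isSplitBasis (h : IsLeonardPair A B θ τ e f) {φ : ℕ → K}
    (hφ : ∀ j < d, B (lowVec A θ (f 0) (j + 1)) =
      τ (j + 1) • lowVec A θ (f 0) (j + 1) + φ (j + 1) • lowVec A θ (f 0) j) :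
    IsSplitBasis d A B θ τ φ (lowVec A θ (f 0)) where
  linearIndependent := h.linearIndependent_lowVec
  ne_zero j hj := h.ne_zero_of_apply_lowVec hj (hφ j hj)
  lower j _ := by rw [lowVec]; abel
  lower_last := by
    -- The last vector has only the `e`-coordinate `d`, hence is an eigenvector of `A`.
    refine e.ext_elem fun k => ?_
    rw [map_smul, Finsupp.smul_apply, repr_apply_of_eigenbasis e (θ := fun i => θ i) h.eigenA,
      smul_eq_mul]
    rcases (Fin.is_le k).lt_or_eq with hk | hk
    · rw [h.repr_lowVec_below _ k hk]; simp
    · rw [hk]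
  upper_zero := by simpa [lowVec] using h.eigenB 0
  upper := hφ

end IsLeonardPair

end LinearAlgebra

/-! ### The invariant bilinear form and dual split bases. -/

section LinearAlgebra

variable {K V : Type*} [Field K] [AddCommGroup V] [Module K V] {d : ℕ}

/-- An irreducible tridiagonal matrix is symmetrized by a nonsingular diagonal matrix. -/
theorem IsIrredTridiagonal.exists_symmetrizer {M : Matrix (Fin (d + 1)) (Fin (d + 1)) K}
    (hM : IsIrredTridiagonal M) :
    ∃ k : Fin (d + 1) → K, (∀ i, k i ≠ 0) ∧ ∀ i j, k i * M i j = k j * M j i := by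
  -- Symmetry at neighbouring indices forces `k (n + 1) / k n` to be this ratio, so `k` is the
  -- product of the ratios. The value `1` from `d` on only keeps `r` nonvanishing.
  set r : ℕ → K := fun n => if h : n < d then
    M ⟨n, by omega⟩ ⟨n + 1, by omega⟩ / M ⟨n + 1, by omega⟩ ⟨n, by omega⟩ else 1 with hr
  have hr0 : ∀ n, r n ≠ 0 := by
    intro n
    by_cases h : n < d
    · simp only [hr, h, dif_pos]
      exact div_ne_zero ((hM _ _).2 (by simp)) ((hM _ _).2 (by simp))
    · simp [hr, h]
  have step : ∀ i j : Fin (d + 1), (i : ℕ) = j + 1 →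
      (∏ h ∈ Finset.range i, r h) * M i j = (∏ h ∈ Finset.range j, r h) * M j i := by
    intro i j hij
    have hj : (j : ℕ) < d := by omega
    have e1 : (⟨(j : ℕ) + 1, by omega⟩ : Fin (d + 1)) = i := Fin.ext hij.symm
    have hne : M i j ≠ 0 := (hM i j).2 (by rw [hij]; simp)
    rw [hij, Finset.prod_range_succ, mul_assoc]
    congr 1
    simp only [hr, hj, dif_pos, e1, Fin.eta]
    exact div_mul_cancel₀ _ hne
  refine ⟨fun i => ∏ h ∈ Finset.range i, r h,
    fun i => Finset.prod_ne_zero_iff.2 fun h _ => hr0 h, fun i j => ?_⟩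
  by_cases h1 : (i : ℕ) = j + 1
  · exact step i j h1
  by_cases h2 : (j : ℕ) = i + 1
  · exact (step j i h2).symm
  by_cases h3 : i = j
  · rw [h3]
  have h3' : (i : ℕ) ≠ j := fun h => h3 (Fin.ext h)
  rw [(hM i j).1 (by rw [lt_abs]; omega), (hM j i).1 (by rw [lt_abs]; omega)]
  simp

/-- A Leonard pair is self-adjoint for some nondegenerate bilinear form. -/
theorem IsLeonardPair.exists_form {A B : Module.End K V} {θ τ : ℕ → K}
    {e f : Module.Basis (Fin (d + 1)) K V} (h : IsLeonardPair A B θ τ e f) :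
    ∃ Q : LinearMap.BilinForm K V, Q.Nondegenerate ∧ (∀ x y, Q (A x) y = Q x (A y)) ∧
      ∀ x y, Q (B x) y = Q x (B y) := by
  obtain ⟨k, hk0, hk⟩ := h.tridiagA.exists_symmetrizer
  have hQ : ∀ i j, Matrix.toBilin f (Matrix.diagonal k) (f i) (f j) =
      if i = j then k i else 0 := by
    intro i j
    rw [← LinearMap.BilinForm.toMatrix_apply, LinearMap.BilinForm.toMatrix_toBilin,
      Matrix.diagonal_apply]
  -- The form makes `f` orthogonal with norms `k`. Then `B`, diagonal in `f`, is self-adjoint at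
  -- once, and for `A` self-adjointness is the symmetrizer identity.
  refine ⟨Matrix.toBilin f (Matrix.diagonal k), Matrix.Nondegenerate.toBilin ?_ f, ?_, ?_⟩
  · rw [Matrix.nondegenerate_iff_det_ne_zero, Matrix.det_diagonal]
    exact Finset.prod_ne_zero_iff.2 fun i _ => hk0 i
  · have hA : ∀ i, A (f i) = ∑ j, LinearMap.toMatrix f f A j i • f j := by
      intro i
      conv_lhs => rw [← f.sum_repr (A (f i))]
      simp [LinearMap.toMatrix_apply]
    have := LinearMap.ext_basis (B := (Matrix.toBilin f (Matrix.diagonal k)).compLeft A)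
      (B' := (Matrix.toBilin f (Matrix.diagonal k)).compRight A) f f fun i j => by
        simp only [LinearMap.BilinForm.compLeft_apply, LinearMap.BilinForm.compRight_apply, hA,
          map_sum, map_smul, LinearMap.sum_apply, LinearMap.smul_apply, hQ]
        simpa [mul_comm] using hk j i
    exact fun x y => LinearMap.congr_fun₂ this x y
  · have := LinearMap.ext_basis (B := (Matrix.toBilin f (Matrix.diagonal k)).compLeft B)
      (B' := (Matrix.toBilin f (Matrix.diagonal k)).compRight B) f f fun i j => by
        simp only [LinearMap.BilinForm.compLeft_apply, LinearMap.BilinForm.compRight_apply,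
          h.eigenB, map_smul, LinearMap.smul_apply, hQ]
        by_cases hij : i = j <;> simp [hij]
    exact fun x y => LinearMap.congr_fun₂ this x y

/-- The reversed dual basis of a split basis is a split basis. -/
theorem IsSplitBasis.exists_dual {X Y : Module.End K V} {ξ ζ φ : ℕ → K} {v : ℕ → V}
    (h : IsSplitBasis d X Y ξ ζ φ v) (hV : Module.finrank K V = d + 1)
    {Q : LinearMap.BilinForm K V} (hQ : Q.Nondegenerate) (hX : ∀ x y, Q (X x) y = Q x (X y))
    (hY : ∀ x y, Q (Y x) y = Q x (Y y)) :
    ∃ w : ℕ → V, IsSplitBasis d X Y (fun i => ξ (d - i)) (fun i => ζ (d - i))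
      (fun i => φ (d - i + 1)) w := by
  set b := h.basis hV with hb
  set D : ℕ → V := fun n => Q.dualBasis hQ b ⟨d - n, by omega⟩ with hD
  have hDv : ∀ n k, n ≤ d → k ≤ d → Q (D n) (v k) = if k = d - n then 1 else 0 := by
    intro n k hn hk
    have := LinearMap.BilinForm.apply_dualBasis_left hQ b ⟨d - n, by omega⟩ ⟨k, by omega⟩
    rw [h.basis_apply hV] at this
    simpa using this
  have hext : ∀ x y, (∀ k ≤ d, Q x (v k) = Q y (v k)) → x = y := by
    intro x y hxy
    refine (Q.dualBasis hQ b).ext_elem fun k => ?_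
    rw [LinearMap.BilinForm.dualBasis_repr_apply, LinearMap.BilinForm.dualBasis_repr_apply,
      h.basis_apply hV]
    exact hxy k (by omega)
  -- Passing to the dual basis transposes both matrices, and reversing the order restores their
  -- shapes with the parameters reversed. Each relation is checked by pairing with every `v k` and
  -- moving the operator to the right-hand argument.
  refine ⟨D, ⟨?_, fun j hj => h.ne_zero _ (by omega), fun n hn => hext _ _ fun k hk => ?_,
    hext _ _ fun k hk => ?_, hext _ _ fun k hk => ?_, fun n hn => hext _ _ fun k hk => ?_⟩⟩
  · convert (Q.dualBasis hQ b).linearIndependent.comp Fin.rev Fin.rev_injective using 2 with i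
    simp only [hD, Function.comp_apply]
    congr 1
    ext
    simp only [Fin.val_rev]
    omega
  · rw [hX]
    simp only [map_add, map_smul, LinearMap.add_apply, LinearMap.smul_apply]
    rcases hk.lt_or_eq with hk' | rfl
    · rw [h.lower k hk', map_add, map_smul, hDv n (k + 1) hn.le hk', hDv n k hn.le hk,
        hDv (n + 1) k hn hk]
      by_cases h1 : k = d - n
      · subst h1; simp [show d - n ≠ d - (n + 1) by omega]
      · by_cases h2 : k = d - (n + 1)
        · simp [h2, show d - (n + 1) + 1 = d - n by omega, show d - (n + 1) ≠ d - n by omega]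
        · simp [h1, h2, show k + 1 ≠ d - n by omega]
    · rw [h.lower_last, map_smul, hDv n _ hn.le hk, hDv (n + 1) _ hn hk]
      by_cases h1 : k = k - n
      · rw [← h1]; simp [show k ≠ k - (n + 1) by omega]
      · simp [h1, show k ≠ k - (n + 1) by omega]
  · rw [hX]
    simp only [map_smul, LinearMap.smul_apply]
    rcases hk.lt_or_eq with hk' | rfl
    · rw [h.lower k hk', map_add, map_smul, hDv d (k + 1) le_rfl hk', hDv d k le_rfl hk]
      by_cases h1 : k = 0 <;> simp [h1]
    · rw [h.lower_last, map_smul, hDv k _ le_rfl hk]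
      by_cases h1 : k = 0 <;> simp [h1]
  · rw [hY]
    simp only [map_smul, LinearMap.smul_apply, Nat.sub_zero]
    rcases Nat.eq_zero_or_pos k with rfl | hk'
    · rw [h.upper_zero, map_smul, hDv 0 0 (Nat.zero_le _) hk]
      by_cases h1 : 0 = d
      · simp [← h1]
      · simp [h1]
    · obtain ⟨k, rfl⟩ : ∃ m, k = m + 1 := ⟨k - 1, by omega⟩
      rw [h.upper k hk, map_add, map_smul, map_smul, hDv 0 _ (Nat.zero_le _) hk,
        hDv 0 k (Nat.zero_le _) (by omega)]
      by_cases h1 : k + 1 = d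
      · simp [h1, show k ≠ d by omega]
      · simp [h1, show k ≠ d by omega]
  · rw [hY]
    simp only [map_add, map_smul, LinearMap.add_apply, LinearMap.smul_apply]
    rcases Nat.eq_zero_or_pos k with rfl | hk'
    · rw [h.upper_zero, map_smul, hDv (n + 1) 0 hn hk, hDv n 0 hn.le hk]
      by_cases h1 : 0 = d - (n + 1)
      · simp [← h1, show 0 ≠ d - n by omega]
      · simp [h1, show 0 ≠ d - n by omega]
    · obtain ⟨k, rfl⟩ : ∃ m, k = m + 1 := ⟨k - 1, by omega⟩
      rw [h.upper k hk, map_add, map_smul, map_smul, hDv (n + 1) _ hn hk,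
        hDv (n + 1) k hn (by omega), hDv n _ hn.le hk]
      by_cases h1 : k + 1 = d - (n + 1)
      · simp [← h1, show k + 1 ≠ d - n by omega]
      · by_cases h2 : k = d - (n + 1)
        · simp [h2, show d - (n + 1) + 1 = d - n by omega, show d - n ≠ d - (n + 1) by omega]
        · simp [h1, h2, show k + 1 ≠ d - n by omega]

/-! ### Matrix entries in an eigenbasis, computed from two split bases. -/

/-- A vanishing coordinate would persist along the sequence `lowVec X ξ x`, which spans. This allows
the eigenbasis to be rescaled so that it sums to `x`. -/
theorem IsSplitBasis.repr_ne_zero {X Y : Module.End K V} {ξ ζ φ : ℕ → K} {x : V}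
    (h : IsSplitBasis d X Y ξ ζ φ (lowVec X ξ x)) (e : Module.Basis (Fin (d + 1)) K V) {ν : ℕ → K}
    (he : ∀ i : Fin (d + 1), X (e i) = ν i • e i) (k : Fin (d + 1)) : e.repr x k ≠ 0 := by
  intro h0
  have hspan : Submodule.span K (Set.range fun i : Fin (d + 1) => lowVec X ξ x i) = ⊤ := by
    have : Module.Finite K V := Module.Finite.of_basis e
    exact h.linearIndependent.span_eq_top_of_card_eq_finrank
      (Module.finrank_eq_card_basis e).symm
  have hrec : ∀ n, e.repr (lowVec X ξ x n) k = 0 := by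
    intro n
    induction n with
    | zero => exact h0
    | succ n ih =>
      rw [lowVec, map_sub, map_smul, Finsupp.sub_apply, Finsupp.smul_apply,
        repr_apply_of_eigenbasis e (θ := fun i => ν i) he, ih]
      simp
  have h1 : e.coord k = 0 := LinearMap.ext_on_range hspan fun i => by
    simpa [Module.Basis.coord_apply] using hrec i
  have h2 := LinearMap.congr_fun h1 (e k)
  simp at h2

/-- The superdiagonal entries of `Y` in an eigenbasis of `X` that sums to `x`. -/
theorem IsSplitBasis.superdiag {X Y : Module.End K V} {ξ ζ φ : ℕ → K} {x : V}
    (h : IsSplitBasis d X Y ξ ζ φ (lowVec X ξ x)) (g : Module.Basis (Fin (d + 1)) K V)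
    (hg : ∀ i : Fin (d + 1), X (g i) = ξ i • g i) (hx : ∀ i, g.repr x i = 1)
    (hY : IsIrredTridiagonal (LinearMap.toMatrix g g Y)) {j k : Fin (d + 1)}
    (hjk : (k : ℕ) = j + 1) :
    LinearMap.toMatrix g g Y j k * prodBelow ξ k = φ k * prodBelow ξ j := by
  have hrepr : ∀ (i : Fin (d + 1)) (n : ℕ),
      g.repr (lowVec X ξ x n) i = ∏ h ∈ Finset.range n, (ξ i - ξ h) := by
    intro i n
    rw [repr_lowVec g hg, hx, mul_one]
  have hzero : ∀ (i : Fin (d + 1)) (n : ℕ), (i : ℕ) < n → g.repr (lowVec X ξ x n) i = 0 := by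
    intro i n hin
    rw [hrepr, Finset.prod_eq_zero (Finset.mem_range.2 hin) (sub_self _)]
  -- In coordinate `j` of the relation for `Y`, the diagonal term drops out, since its product
  -- contains `ξ j - ξ j`. On the left only the term with index `k = j + 1` of the matrix product
  -- remains.
  have h1 := congrArg (fun y => g.repr y j) (h.upper j (by omega))
  simp only [map_add, map_smul, Finsupp.add_apply, Finsupp.smul_apply, smul_eq_mul] at h1
  rw [hzero j _ (Nat.lt_succ_self _), mul_zero, zero_add, ← hjk,
    repr_apply_eq_of_below g hY (fun i hi => hzero i _ hi) hjk, hrepr, hrepr] at h1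
  exact h1

theorem prodBelow_rev (ξ : ℕ → K) {i : ℕ} (hi : i ≤ d) :
    prodBelow (fun n => ξ (d - n)) i = prodAbove d ξ (d - i) := by
  unfold prodBelow prodAbove
  refine Finset.prod_bij' (fun n _ => d - n) (fun n _ => d - n) ?_ ?_ ?_ ?_ ?_
  · intro n hn; simp only [Finset.mem_range, Finset.mem_Ioc] at *; omega
  · intro n hn; simp only [Finset.mem_range, Finset.mem_Ioc] at *; omega
  · intro n hn; simp only [Finset.mem_range] at *; omega
  · intro n hn; simp only [Finset.mem_Ioc] at *; omega
  · intro n hn; rfl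

theorem prodBelow_ne_zero {ξ : ℕ → K} (hξ : ∀ i j : Fin (d + 1), ξ i = ξ j → i = j) {i : ℕ}
    (hi : i ≤ d) : prodBelow ξ i ≠ 0 := by
  refine Finset.prod_ne_zero_iff.2 fun h hh h0 => ?_
  have hh' := Finset.mem_range.1 hh
  have := congrArg Fin.val (hξ ⟨i, by omega⟩ ⟨h, by omega⟩ (sub_eq_zero.1 h0))
  simp only at this
  omega

theorem prodAbove_ne_zero {ξ : ℕ → K} (hξ : ∀ i j : Fin (d + 1), ξ i = ξ j → i = j) {i : ℕ}
    (hi : i ≤ d) : prodAbove d ξ i ≠ 0 := by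
  refine Finset.prod_ne_zero_iff.2 fun h hh h0 => ?_
  have hh' := Finset.mem_Ioc.1 hh
  have := congrArg Fin.val (hξ ⟨i, by omega⟩ ⟨h, by omega⟩ (sub_eq_zero.1 h0))
  simp only at this
  omega

theorem toMatrix_unitsSMul (e : Module.Basis (Fin (d + 1)) K V) (c : Fin (d + 1) → Kˣ)
    (Y : Module.End K V) (i j : Fin (d + 1)) :
    LinearMap.toMatrix (e.unitsSMul c) (e.unitsSMul c) Y i j =
      (c i : K)⁻¹ * LinearMap.toMatrix e e Y i j * c j := by
  rw [LinearMap.toMatrix_apply, LinearMap.toMatrix_apply, Module.Basis.repr_unitsSMul,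
    Module.Basis.unitsSMul_apply, Units.smul_def, Units.smul_def, map_smul, map_smul,
    Finsupp.smul_apply, smul_eq_mul, smul_eq_mul, Units.val_inv_eq_inv_val]
  ring

theorem IsIrredTridiagonal.toMatrix_unitsSMul {e : Module.Basis (Fin (d + 1)) K V}
    {Y : Module.End K V} (h : IsIrredTridiagonal (LinearMap.toMatrix e e Y))
    (c : Fin (d + 1) → Kˣ) :
    IsIrredTridiagonal (LinearMap.toMatrix (e.unitsSMul c) (e.unitsSMul c) Y) := by
  intro i j
  rw [_root_.toMatrix_unitsSMul]
  exact ⟨fun hij => by rw [(h i j).1 hij]; simp, fun hij =>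
    mul_ne_zero (mul_ne_zero (inv_ne_zero (c i).ne_zero) ((h i j).2 hij)) (c j).ne_zero⟩

/-- The matrices of `X` and `Y` in the basis formed by the projections of `x` to the eigenspaces
of `X`. -/
theorem exists_basis_of_isSplitBasis {X Y : Module.End K V} {ξ ζ ζ' φ ψ : ℕ → K} {x : V}
    (h : IsSplitBasis d X Y ξ ζ φ (lowVec X ξ x))
    (h' : IsSplitBasis d X Y (fun i => ξ (d - i)) ζ' ψ (lowVec X (fun i => ξ (d - i)) x))
    (e : Module.Basis (Fin (d + 1)) K V) (he : ∀ i : Fin (d + 1), X (e i) = ξ i • e i)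
    (hξ : ∀ i j : Fin (d + 1), ξ i = ξ j → i = j)
    (hY : IsIrredTridiagonal (LinearMap.toMatrix e e Y)) {a : ℕ → K}
    (ha : ∀ i : Fin (d + 1), LinearMap.toMatrix e e Y i i = a i) :
    ∃ g : Module.Basis (Fin (d + 1)) K V, (∀ i, g i = e.repr x i • e i) ∧
      LinearMap.toMatrix g g X = triMat 0 ξ 0 ∧
      LinearMap.toMatrix g g Y =
        triMat (fun i => ψ (d - i + 1) * (prodAbove d ξ i / prodAbove d ξ (i - 1))) a
          (fun i => φ i * (prodBelow ξ (i - 1) / prodBelow ξ i)) := by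
  have hc := h.repr_ne_zero e he
  set c : Fin (d + 1) → Kˣ := fun i => Units.mk0 _ (hc i) with hcdef
  set g := e.unitsSMul c with hgdef
  have hgi : ∀ i, g i = e.repr x i • e i := fun i => by
    rw [hgdef, Module.Basis.unitsSMul_apply]; rfl
  have hg : ∀ i : Fin (d + 1), X (g i) = ξ i • g i := fun i => by
    rw [hgi, map_smul, he, smul_comm]
  have hx : ∀ i, g.repr x i = 1 := fun i => by
    rw [hgdef, Module.Basis.repr_unitsSMul, Units.smul_def, Units.val_inv_eq_inv_val]
    exact inv_mul_cancel₀ (hc i)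
  have hYg : IsIrredTridiagonal (LinearMap.toMatrix g g Y) := hY.toMatrix_unitsSMul c
  refine ⟨g, hgi, ?_, ?_⟩
  · ext i j
    rw [LinearMap.toMatrix_apply, hg]
    by_cases hij : i = j
    · simp [triMat, hij]
    · have : (i : ℕ) ≠ j := fun hh => hij (Fin.ext hh)
      simp [triMat, this, Ne.symm hij]
  · have hsub : ∀ i j : Fin (d + 1), (i : ℕ) = j + 1 → LinearMap.toMatrix g g Y i j =
        ψ (d - i + 1) * (prodAbove d ξ i / prodAbove d ξ (i - 1)) := by
      intro i j hij
      -- The reversed basis still sums to `x`, and its superdiagonal is the subdiagonal of `g`; so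
      -- `h'`, with the eigenvalues in reverse order, determines it.
      have hr := h'.superdiag (g.reindex Fin.revPerm) (j := i.rev) (k := j.rev)
        (fun k => by
          have : d - (k : ℕ) = (k.rev : ℕ) := by rw [Fin.val_rev]; omega
          rw [Module.Basis.reindex_apply, Fin.revPerm_symm, Fin.revPerm_apply, hg, this])
        (fun k => by rw [Module.Basis.repr_reindex_apply]; exact hx _)
        (fun k l => by
          rw [LinearMap.toMatrix_apply, Module.Basis.reindex_apply,
            Module.Basis.repr_reindex_apply, ← abs_rev_sub_rev]
          have := hYg k.rev l.rev
          rw [LinearMap.toMatrix_apply] at this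
          exact this)
        (by rw [Fin.val_rev, Fin.val_rev]; omega)
      have e1 : ((i.rev : Fin (d + 1)) : ℕ) = d - i := by rw [Fin.val_rev]; omega
      have e2 : ((j.rev : Fin (d + 1)) : ℕ) = d - i + 1 := by rw [Fin.val_rev]; omega
      rw [LinearMap.toMatrix_apply, Module.Basis.reindex_apply, Module.Basis.repr_reindex_apply,
        Fin.revPerm_symm, Fin.revPerm_apply, Fin.revPerm_apply, Fin.rev_rev, Fin.rev_rev, e1, e2,
        prodBelow_rev ξ (by omega), prodBelow_rev ξ (by omega),
        show d - (d - (i : ℕ)) = i by omega, show d - (d - (i : ℕ) + 1) = i - 1 by omega,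
        ← LinearMap.toMatrix_apply] at hr
      rw [← mul_div_assoc, eq_div_iff (prodAbove_ne_zero hξ (by omega)), hr]
    ext i j
    simp only [triMat, Matrix.of_apply]
    split_ifs with h1 h2 h3
    · exact hsub i j h1
    · obtain rfl : i = j := Fin.ext h2
      rw [hgdef, toMatrix_unitsSMul, ha, mul_comm, mul_inv_cancel_left₀ (c i).ne_zero]
    · rw [← mul_div_assoc, eq_div_iff (prodBelow_ne_zero hξ (by omega)),
        h.superdiag g hg hx hYg h3, h3, Nat.add_sub_cancel]
    · exact (hYg i j).1 (by rw [lt_abs]; omega)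

end LinearAlgebra

theorem seqNat_coe {M : Type*} [Zero M] {d : ℕ} (f : Fin (d + 1) → M) (i : Fin (d + 1)) :
    seqNat f i = f i := by
  rw [seqNat, dif_pos i.2]

theorem seqNat_rev {M : Type*} [Zero M] {d : ℕ} (f : Fin (d + 1) → M) {n : ℕ} (hn : n ≤ d) :
    seqNat (fun i => f i.rev) n = seqNat f (d - n) := by
  have h : d - n < d + 1 := by omega
  simp only [seqNat, dif_pos h, dif_pos (Nat.lt_succ_of_le hn)]
  congr 1
  ext
  simp only [Fin.val_rev]
  omega

/-! ### The simple module, primitive idempotents, and the first split sequence. -/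

section Module

variable {K 𝒜 V : Type*} [Field K] [Ring 𝒜] [Algebra K 𝒜] {d : ℕ}
  [AddCommGroup V] [Module K V] [Module 𝒜 V] [IsScalarTower K 𝒜 V]

/-- A simple module over an algebra isomorphic to a matrix algebra is the module of columns. -/
theorem exists_basis_toMatrix_lsmul_eq [IsSimpleModule 𝒜 V]
    (σ : 𝒜 ≃ₐ[K] Matrix (Fin (d + 1)) (Fin (d + 1)) K) :
    ∃ w : Module.Basis (Fin (d + 1)) K V,
      ∀ X : 𝒜, LinearMap.toMatrix w w (Algebra.lsmul K K V X) = σ X := by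
  set ε : Fin (d + 1) → Fin (d + 1) → 𝒜 := fun i j => σ.symm (Matrix.single i j 1) with hε
  have hmul : ∀ i j k l, ε i j * ε k l = if j = k then ε i l else 0 := by
    intro i j k l
    simp only [hε, ← map_mul]
    split_ifs with h
    · subst h; simp
    · rw [Matrix.single_mul_single_of_ne (h := h), map_zero]
  have hone : ∑ i, ε i i = 1 := by
    simp only [hε, ← map_sum, Matrix.sum_single_one, map_one]
  have hX : ∀ (X : 𝒜) (j i : Fin (d + 1)), X * ε j i = ∑ k, σ X k j • ε k i := by
    intro X j i
    apply σ.injective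
    ext a b
    simp only [hε, map_mul, AlgEquiv.apply_symm_apply, map_sum, map_smul, Matrix.sum_apply,
      Matrix.smul_apply, Matrix.single_apply, smul_eq_mul, Matrix.mul_apply]
    by_cases h : i = b <;> simp [h]
  have : Nontrivial V := IsSimpleModule.nontrivial 𝒜 V
  obtain ⟨x, hx⟩ := exists_ne (0 : V)
  -- The diagonal matrix units sum to `1`, so one of them does not kill `x`. The vectors `ε j i • x`
  -- then transform like the standard columns.
  obtain ⟨i, hi⟩ : ∃ i, ε i i • x ≠ 0 := by
    by_contra! h
    apply hx
    rw [← one_smul 𝒜 x, ← hone, Finset.sum_smul]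
    exact Finset.sum_eq_zero fun i _ => h i
  set w : Fin (d + 1) → V := fun j => ε j i • x with hw
  have hXw : ∀ (X : 𝒜) (j : Fin (d + 1)), X • w j = ∑ k, σ X k j • w k := by
    intro X j
    simp only [hw, smul_smul, hX, Finset.sum_smul, smul_assoc]
  have hli : LinearIndependent K w := by
    rw [Fintype.linearIndependent_iff]
    intro c hc k
    have h1 := congrArg (fun y => ε i k • y) hc
    have h2 : ∀ j, ε i k • c j • w j = if k = j then c j • ε i i • x else 0 := by
      intro j
      rw [smul_algebra_smul_comm, hw, smul_smul, hmul]
      split_ifs <;> simp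
    simp only [Finset.smul_sum, smul_zero, h2, Finset.sum_ite_eq, Finset.mem_univ, if_true] at h1
    exact (smul_eq_zero.1 h1).resolve_right hi
  -- The span of the columns is stable under `𝒜` and nonzero, hence all of `V` by simplicity.
  let N : Submodule 𝒜 V :=
    { (Submodule.span K (Set.range w)).toAddSubmonoid with
      smul_mem' := fun X y hy => by
        have hle : Submodule.span K (Set.range w) ≤
            (Submodule.span K (Set.range w)).comap (Algebra.lsmul K K V X) := by
          rw [Submodule.span_le]
          rintro _ ⟨j, rfl⟩
          simp only [Submodule.comap_coe, Set.mem_preimage, Algebra.lsmul_coe, SetLike.mem_coe]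
          rw [hXw]
          exact Submodule.sum_mem _ fun k _ =>
            Submodule.smul_mem _ _ (Submodule.subset_span ⟨k, rfl⟩)
        exact hle hy }
  have hmemN : ∀ y, y ∈ N ↔ y ∈ Submodule.span K (Set.range w) := fun y => Iff.rfl
  have hN : N = ⊤ := by
    refine (eq_bot_or_eq_top N).resolve_left fun h => hi ?_
    have : w i ∈ N := (hmemN _).2 (Submodule.subset_span ⟨i, rfl⟩)
    rw [h] at this
    simpa [hw] using this
  refine ⟨Module.Basis.mk hli fun y _ => (hmemN y).1 (hN ▸ Submodule.mem_top), fun X => ?_⟩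
  set b := Module.Basis.mk hli fun y _ => (hmemN y).1 (hN ▸ Submodule.mem_top) with hb
  ext k j
  have hbw : ∀ j, b j = w j := fun j => Module.Basis.mk_apply _ _ j
  have hXb : Algebra.lsmul K K V X (b j) = ∑ k, σ X k j • b k := by
    simp only [hbw]
    exact hXw X j
  rw [LinearMap.toMatrix_apply, hXb]
  simp only [map_sum, map_smul, Module.Basis.repr_self, Finsupp.coe_finsetSum,
    Finset.sum_apply, Finsupp.smul_apply, Finsupp.single_apply, smul_eq_mul]
  simp

theorem lsmul_injective [IsSimpleModule 𝒜 V]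
    (σ : 𝒜 ≃ₐ[K] Matrix (Fin (d + 1)) (Fin (d + 1)) K) :
    Function.Injective (Algebra.lsmul K K V : 𝒜 →ₐ[K] Module.End K V) := by
  obtain ⟨w, hw⟩ := exists_basis_toMatrix_lsmul_eq (V := V) σ
  intro X Y h
  apply σ.injective
  rw [← hw, ← hw, h]

theorem finrank_eq_of_algEquiv [IsSimpleModule 𝒜 V]
    (σ : 𝒜 ≃ₐ[K] Matrix (Fin (d + 1)) (Fin (d + 1)) K) : Module.finrank K V = d + 1 := by
  obtain ⟨w, -⟩ := exists_basis_toMatrix_lsmul_eq (V := V) σ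
  rw [Module.finrank_eq_card_basis w, Fintype.card_fin]

theorem trace_algEquiv [IsSimpleModule 𝒜 V]
    (σ : 𝒜 ≃ₐ[K] Matrix (Fin (d + 1)) (Fin (d + 1)) K) (X : 𝒜) :
    (σ X).trace = LinearMap.trace K V (Algebra.lsmul K K V X) := by
  obtain ⟨w, hw⟩ := exists_basis_toMatrix_lsmul_eq (V := V) σ
  rw [← hw, LinearMap.trace_eq_matrix_trace K w]

/-- `e` is an eigenbasis of `A`, with respect to which the `Eᵢ` are the projections. -/
structure IsEigenbasis (A : 𝒜) (θ : Fin (d + 1) → K) (E : Fin (d + 1) → 𝒜)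
    (e : Module.Basis (Fin (d + 1)) K V) : Prop where
  smul_eq : ∀ i, A • e i = θ i • e i
  proj_smul : ∀ i x, E i • x = e.repr x i • e i

/-- Faithfulness preserves the minimal polynomial, so its `d + 1` distinct roots are eigenvalues on
a space of dimension `d + 1`. The polynomial defining `E i` is the Lagrange interpolant that is `1`
at `θ i` and `0` at the other eigenvalues. -/
theorem IsPrimitiveIdempotents.exists_isEigenbasis {A : 𝒜} {θ : Fin (d + 1) → K}
    {E : Fin (d + 1) → 𝒜} (h : IsPrimitiveIdempotents A θ E)
    (hV : Module.finrank K V = d + 1)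
    (hinj : Function.Injective (Algebra.lsmul K K V : 𝒜 →ₐ[K] Module.End K V)) :
    ∃ e : Module.Basis (Fin (d + 1)) K V, IsEigenbasis A θ E e := by
  set T : 𝒜 →ₐ[K] Module.End K V := Algebra.lsmul K K V with hT
  have : FiniteDimensional K V := Module.finite_of_finrank_pos (by omega)
  have hev : ∀ i, ∃ x : V, (T A).HasEigenvector (θ i) x := by
    intro i
    have hr : (minpoly K (T A)).IsRoot (θ i) := by
      rw [minpoly.algHom_eq T hinj]
      exact (h.isRoot_iff _).2 ⟨i, rfl⟩
    exact (Module.End.hasEigenvalue_of_isRoot hr).exists_hasEigenvector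
  choose x hx using hev
  have hli : LinearIndependent K x :=
    Module.End.eigenvectors_linearIndependent' (T A) θ h.injective x hx
  have hcard : Fintype.card (Fin (d + 1)) = Module.finrank K V := by simp [hV]
  set e := basisOfLinearIndependentOfCardEqFinrank hli hcard with he
  have hex : ∀ i, e i = x i := fun i => by simp [he]
  have hE : ∀ i j, E i • e j = if j = i then e j else 0 := by
    intro i j
    have h1 : E i • e j = T (E i) (e j) := rfl
    rw [h1, h.E_eq, ← aeval_algHom_apply, hex,
      Module.End.aeval_apply_of_hasEigenvector (hx j), eval_prod]
    split_ifs with hij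
    · subst hij
      rw [Finset.prod_eq_one, one_smul]
      intro k hk
      simp only [eval_mul, eval_C, eval_sub, eval_X]
      exact inv_mul_cancel₀ (sub_ne_zero.2 fun hh => (Finset.mem_erase.1 hk).1
        (h.injective hh).symm)
    · rw [Finset.prod_eq_zero (Finset.mem_erase.2 ⟨hij, Finset.mem_univ j⟩), zero_smul]
      simp
  refine ⟨e, fun i => ?_, fun i y => ?_⟩
  · rw [hex]; exact (hx i).apply_eq_smul
  · conv_lhs => rw [← e.sum_repr y]
    simp only [Finset.smul_sum, smul_algebra_smul_comm _ (E i), hE]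
    simp

namespace IsEigenbasis

variable {A : 𝒜} {θ : Fin (d + 1) → K} {E : Fin (d + 1) → 𝒜}
  {e : Module.Basis (Fin (d + 1)) K V}

theorem rev (h : IsEigenbasis A θ E e) :
    IsEigenbasis A (fun i => θ i.rev) (fun i => E i.rev) (e.reindex Fin.revPerm) where
  smul_eq i := by simpa using h.smul_eq i.rev
  proj_smul i x := by simpa using h.proj_smul i.rev x

theorem mem_image_iff (h : IsEigenbasis A θ E e) {i : Fin (d + 1)} {x : V} :
    x ∈ LeonardSystem.image (K := K) V (E i) ↔ ∃ c : K, x = c • e i := by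
  constructor
  · rintro ⟨y, rfl⟩
    exact ⟨_, h.proj_smul i y⟩
  · rintro ⟨c, rfl⟩
    exact ⟨c • e i, by simp [h.proj_smul]⟩

/-- Translates membership in the split spaces into the coordinate conditions used for Leonard pairs.
-/
theorem mem_iSup_image_iff (h : IsEigenbasis A θ E e) {p : Fin (d + 1) → Prop} {x : V} :
    x ∈ (⨆ j : Fin (d + 1), ⨆ _ : p j, LeonardSystem.image (K := K) V (E j)) ↔
      ∀ k, ¬ p k → e.repr x k = 0 := by
  constructor
  · intro hx k hk
    have hle : (⨆ j : Fin (d + 1), ⨆ _ : p j, LeonardSystem.image (K := K) V (E j)) ≤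
        LinearMap.ker (e.coord k) := by
      refine iSup₂_le fun j hj y hy => ?_
      obtain ⟨c, rfl⟩ := h.mem_image_iff.1 hy
      have : j ≠ k := fun hjk => hk (hjk ▸ hj)
      simp [this]
    exact hle hx
  · intro hx
    rw [← e.sum_repr x]
    refine Submodule.sum_mem _ fun k _ => ?_
    by_cases hk : p k
    · exact Submodule.mem_iSup_of_mem k (Submodule.mem_iSup_of_mem hk
        (h.mem_image_iff.2 ⟨_, rfl⟩))
    · rw [hx k hk, zero_smul]
      exact Submodule.zero_mem _

/-- `E i * B * E j` acts as the matrix entry at `(i, j)` times a nonzero rank-one map, so by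
faithfulness one vanishes exactly when the other does. -/
theorem isIrredTridiagonal (h : IsEigenbasis A θ E e) {B : 𝒜}
    (hinj : Function.Injective (Algebra.lsmul K K V : 𝒜 →ₐ[K] Module.End K V))
    (hfar : ∀ i j : Fin (d + 1), 1 < |(i : ℤ) - (j : ℤ)| → E i * B * E j = 0)
    (hnear : ∀ i j : Fin (d + 1), |(i : ℤ) - (j : ℤ)| = 1 → E i * B * E j ≠ 0) :
    IsIrredTridiagonal (LinearMap.toMatrix e e (Algebra.lsmul K K V B)) := by
  have hact : ∀ (i j : Fin (d + 1)) (x : V), (E i * B * E j) • x =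
      e.repr x j • LinearMap.toMatrix e e (Algebra.lsmul K K V B) i j • e i := by
    intro i j x
    rw [mul_smul, mul_smul, h.proj_smul j, smul_algebra_smul_comm _ B, smul_algebra_smul_comm _ (E i),
      h.proj_smul i, LinearMap.toMatrix_apply, Algebra.lsmul_coe]
  refine fun i j => ⟨fun hij => ?_, fun hij h0 => hnear i j hij (hinj ?_)⟩
  · have h1 := hact i j (e j)
    rw [hfar i j hij, zero_smul, Module.Basis.repr_self, Finsupp.single_eq_same, one_smul] at h1
    exact (smul_eq_zero.1 h1.symm).resolve_right (e.ne_zero i)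
  · ext x
    change (E i * B * E j) • x = _
    rw [hact, h0]
    simp

/-- In the eigenbasis, `B * E i` keeps only column `i` of the matrix of `B`. -/
theorem trace_mul_eq [IsSimpleModule 𝒜 V] (h : IsEigenbasis A θ E e)
    (σ : 𝒜 ≃ₐ[K] Matrix (Fin (d + 1)) (Fin (d + 1)) K) (B : 𝒜) (i : Fin (d + 1)) :
    LinearMap.toMatrix e e (Algebra.lsmul K K V B) i i = (σ (B * E i)).trace := by
  rw [trace_algEquiv (V := V), LinearMap.trace_eq_matrix_trace K e, Matrix.trace,
    Finset.sum_eq_single i]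
  · simp [LinearMap.toMatrix_apply, h.proj_smul]
  · intro j _ hj
    simp [LinearMap.toMatrix_apply, h.proj_smul, hj]
  · simp

end IsEigenbasis

namespace LeonardSystem

theorem isLeonardPair (Φ : LeonardSystem K 𝒜 d)
    (hinj : Function.Injective (Algebra.lsmul K K V : 𝒜 →ₐ[K] Module.End K V))
    {e f : Module.Basis (Fin (d + 1)) K V} (he : IsEigenbasis Φ.A Φ.θ Φ.E e)
    (hf : IsEigenbasis Φ.As Φ.θs Φ.Es f) :
    IsLeonardPair (Algebra.lsmul K K V Φ.A) (Algebra.lsmul K K V Φ.As) (seqNat Φ.θ)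
      (seqNat Φ.θs) e f where
  eigenA i := by rw [seqNat_coe]; exact he.smul_eq i
  eigenB i := by rw [seqNat_coe]; exact hf.smul_eq i
  injA i j hij := Φ.primA.injective (by rwa [seqNat_coe, seqNat_coe] at hij)
  injB i j hij := Φ.primAs.injective (by rwa [seqNat_coe, seqNat_coe] at hij)
  tridiagA := hf.isIrredTridiagonal hinj Φ.Es_far Φ.Es_near
  tridiagB := he.isIrredTridiagonal hinj Φ.E_far Φ.E_near

/-- The first split sequence appears in the split basis `(A - θ₀) ⋯ (A - θᵢ₋₁) f₀`. -/
theorem isSplitBasis (Φ : LeonardSystem K 𝒜 d)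
    (hinj : Function.Injective (Algebra.lsmul K K V : 𝒜 →ₐ[K] Module.End K V))
    {e f : Module.Basis (Fin (d + 1)) K V} (he : IsEigenbasis Φ.A Φ.θ Φ.E e)
    (hf : IsEigenbasis Φ.As Φ.θs Φ.Es f) :
    IsSplitBasis d (Algebra.lsmul K K V Φ.A) (Algebra.lsmul K K V Φ.As) (seqNat Φ.θ)
      (seqNat Φ.θs) (Φ.firstSplit V)
      (lowVec (Algebra.lsmul K K V Φ.A) (seqNat Φ.θ) (f 0)) := by
  have h := Φ.isLeonardPair hinj he hf
  refine h.isSplitBasis fun j hj => ?_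
  obtain ⟨c, hc⟩ := h.exists_apply_lowVec hj
  set v := lowVec (Algebra.lsmul K K V Φ.A) (seqNat Φ.θ) (f 0) with hv
  have hmem : v (j + 1) ∈ Φ.splitSpace V (j + 1) := by
    refine ⟨hf.mem_iSup_image_iff.2 fun k hk => h.repr_lowVec_above _ k (not_le.1 hk),
      he.mem_iSup_image_iff.2 fun k hk => h.repr_lowVec_below _ k (not_le.1 hk)⟩
  have hspan : ∀ u ∈ Φ.splitSpace V (j + 1), ∃ b : K, u = b • v (j + 1) := fun u hu =>
    h.eq_smul_of_repr hj (fun k hk => hf.mem_iSup_image_iff.1 hu.1 k (not_le.2 hk))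
      (fun k hk => he.mem_iSup_image_iff.1 hu.2 k (not_le.2 hk))
  have hact : ((Φ.A - algebraMap K 𝒜 (seqNat Φ.θ j)) *
      (Φ.As - algebraMap K 𝒜 (seqNat Φ.θs (j + 1)))) • v (j + 1) = c • v (j + 1) := by
    have h1 : (Φ.As - algebraMap K 𝒜 (seqNat Φ.θs (j + 1))) • v (j + 1) = c • v j := by
      rw [sub_smul, algebraMap_smul]
      exact sub_eq_iff_eq_add'.2 hc
    rw [mul_smul, h1, smul_algebra_smul_comm, sub_smul, algebraMap_smul]
    rfl
  have hex : ∃ c : K, ∀ u ∈ Φ.splitSpace V (j + 1),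
      ((Φ.A - algebraMap K 𝒜 (seqNat Φ.θ j)) *
        (Φ.As - algebraMap K 𝒜 (seqNat Φ.θs (j + 1)))) • u = c • u := by
    refine ⟨c, fun u hu => ?_⟩
    obtain ⟨b, rfl⟩ := hspan u hu
    rw [smul_algebra_smul_comm, hact, smul_comm]
  have hne : v (j + 1) ≠ 0 := h.linearIndependent_lowVec.ne_zero (⟨j + 1, by omega⟩ : Fin (d + 1))
  -- A scalar with the defining property exists, and evaluation at the nonzero vector `v (j + 1)`
  -- leaves `c` as the only one; so the choice operator returns `c`.
  have hφ : Φ.firstSplit V (j + 1) = c := by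
    have h1 := Classical.epsilon_spec hex _ hmem
    rw [hact] at h1
    rw [firstSplit, if_pos ⟨by omega, by omega⟩]
    exact (smul_left_injective K hne h1).symm
  rw [hφ, hc]

end LeonardSystem

end Module

/-! ### Families of split bases, representing matrices, and their shapes. -/

section LinearAlgebra

variable {K V : Type*} [Field K] [AddCommGroup V] [Module K V] {d : ℕ}

theorem IsSimpleEigenvector.of_eigenbasis {X : Module.End K V} {ξ : ℕ → K}
    {e : Module.Basis (Fin (d + 1)) K V} (he : ∀ i : Fin (d + 1), X (e i) = ξ i • e i)
    (hξ : ∀ i j : Fin (d + 1), ξ i = ξ j → i = j) {i : Fin (d + 1)} {c : K} (hc : c ≠ 0) :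
    IsSimpleEigenvector X (ξ i) (c • e i) where
  ne_zero := smul_ne_zero hc (e.ne_zero i)
  apply_eq := by rw [map_smul, he, smul_comm]
  eq_smul u hu := by
    refine ⟨e.repr u i * c⁻¹, e.ext_elem fun k => ?_⟩
    have h1 := congrArg (fun y => e.repr y k) hu
    simp only [map_smul, Finsupp.smul_apply, smul_eq_mul] at h1
    rw [repr_apply_of_eigenbasis e (θ := fun i => ξ i) he] at h1
    by_cases hik : i = k
    · subst hik; simp [hc]
    · have h2 : e.repr u k = 0 := by
        by_contra h0
        exact hik (hξ k i (mul_right_cancel₀ h0 h1)).symm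
      simp [h2, hik]

/-- The four split bases, one for each of the four extremal eigenvectors, that a single split
basis of a Leonard pair gives rise to. -/
theorem IsSplitBasis.exists_relatives {A B : Module.End K V} {θ τ φ : ℕ → K} {v : ℕ → V}
    (h : IsSplitBasis d A B θ τ φ v) (hV : Module.finrank K V = d + 1)
    {Q : LinearMap.BilinForm K V} (hQ : Q.Nondegenerate) (hA : ∀ x y, Q (A x) y = Q x (A y))
    (hB : ∀ x y, Q (B x) y = Q x (B y)) {x₀ x₁ y₀ y₁ : V}
    (hx₀ : IsSimpleEigenvector A (θ 0) x₀) (hx₁ : IsSimpleEigenvector A (θ d) x₁)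
    (hy₀ : IsSimpleEigenvector B (τ 0) y₀) (hy₁ : IsSimpleEigenvector B (τ d) y₁) :
    IsSplitBasis d A B θ τ φ (lowVec A θ y₀) ∧
    IsSplitBasis d B A (fun i => τ (d - i)) (fun i => θ (d - i)) (fun i => φ (d - i + 1))
      (lowVec B (fun i => τ (d - i)) x₁) ∧
    IsSplitBasis d A B (fun i => θ (d - i)) (fun i => τ (d - i)) (fun i => φ (d - i + 1))
      (lowVec A (fun i => θ (d - i)) y₁) ∧
    IsSplitBasis d B A τ θ φ (lowVec B τ x₀) := by
  obtain ⟨w, hw⟩ := h.exists_dual hV hQ hA hB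
  -- Dualizing and swapping each reverse the parameters, so together they exchange the operators and
  -- restore the original sequences.
  have hw' : IsSplitBasis d B A τ θ φ _ := hw.swap.congr
    (fun i hi => by simp only [Nat.sub_sub_self hi])
    (fun i hi => by simp only [Nat.sub_sub_self hi])
    (fun i hi => by simp only [show d - (d - (i + 1) + 1) + 1 = i + 1 by omega])
  exact ⟨h.normalize hy₀, h.swap.normalize hx₁, hw.normalize hy₁, hw'.normalize hx₀⟩

theorem triMat_congr {lo di up lo' di' up' : ℕ → K}
    (hlo : ∀ i, 1 ≤ i → i ≤ d → lo i = lo' i) (hdi : ∀ i, i ≤ d → di i = di' i)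
    (hup : ∀ i, 1 ≤ i → i ≤ d → up i = up' i) :
    (triMat lo di up : Matrix (Fin (d + 1)) (Fin (d + 1)) K) = triMat lo' di' up' := by
  ext i j
  simp only [triMat, Matrix.of_apply]
  split_ifs
  · exact hlo _ (by omega) (by omega)
  · exact hdi _ (by omega)
  · exact hup _ (by omega) (by omega)
  · rfl

/-- The vectors `v₀, …, v_d` form a basis, with respect to which `A` and `B` are represented by
the matrices `M.1` and `M.2`. -/
def RepresentedBy (A B : Module.End K V) (v : ℕ → V)
    (M : Matrix (Fin (d + 1)) (Fin (d + 1)) K × Matrix (Fin (d + 1)) (Fin (d + 1)) K) : Prop :=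
  ∃ b : Module.Basis (Fin (d + 1)) K V, (∀ i : Fin (d + 1), b i = v i) ∧
    LinearMap.toMatrix b b A = M.1 ∧ LinearMap.toMatrix b b B = M.2

theorem IsSplitBasis.representedBy {X Y : Module.End K V} {ξ ζ φ : ℕ → K} {v : ℕ → V}
    (h : IsSplitBasis d X Y ξ ζ φ v) (hV : Module.finrank K V = d + 1) :
    RepresentedBy X Y v ((triMat 1 ξ 0, triMat 0 ζ φ) :
      Matrix (Fin (d + 1)) (Fin (d + 1)) K × Matrix (Fin (d + 1)) (Fin (d + 1)) K) := by
  set b := h.basis hV with hb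
  have hbv : ∀ i : Fin (d + 1), b i = v i := h.basis_apply hV
  have hrepr : ∀ (n : ℕ) (hn : n < d + 1), v n = b ⟨n, hn⟩ := fun n hn => (hbv ⟨n, hn⟩).symm
  refine ⟨b, hbv, ?_, ?_⟩
  · ext i j
    rw [LinearMap.toMatrix_apply, hbv]
    rcases (Fin.is_le j).lt_or_eq with hj | hj
    · rw [h.lower j hj, hrepr _ (Nat.succ_lt_succ hj), hrepr _ j.2]
      simp only [map_add, map_smul, Module.Basis.repr_self, Finsupp.add_apply, Finsupp.smul_apply,
        Finsupp.single_apply, Fin.ext_iff, triMat, Matrix.of_apply, eq_comm (b := (i : ℕ))]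
      by_cases h1 : (i : ℕ) = j + 1
      · simp [h1]
      · by_cases h2 : (i : ℕ) = j <;> simp [h1, h2]
    · rw [hj, h.lower_last, hrepr _ (Nat.lt_succ_self d)]
      simp only [map_smul, Module.Basis.repr_self, Finsupp.smul_apply,
        Finsupp.single_apply, Fin.ext_iff, triMat, Matrix.of_apply, hj, eq_comm (b := (i : ℕ))]
      by_cases h2 : (i : ℕ) = d
      · simp [h2]
      · simp [h2, show (i : ℕ) ≠ d + 1 by omega]
  · ext i j
    rw [LinearMap.toMatrix_apply, hbv]
    rcases Nat.eq_zero_or_pos (j : ℕ) with hj | hj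
    · rw [hj, h.upper_zero, hrepr _ (Nat.succ_pos d)]
      simp only [map_smul, Module.Basis.repr_self, Finsupp.smul_apply,
        Finsupp.single_apply, Fin.ext_iff, triMat, Matrix.of_apply, hj, eq_comm (b := (i : ℕ))]
      by_cases h2 : (i : ℕ) = 0 <;> simp [h2]
    · obtain ⟨m, hm⟩ : ∃ m, (j : ℕ) = m + 1 := ⟨j - 1, by omega⟩
      rw [hm, h.upper m (by omega), hrepr m (by omega), hrepr (m + 1) (by omega)]
      simp only [map_add, map_smul, Module.Basis.repr_self, Finsupp.add_apply, Finsupp.smul_apply,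
        Finsupp.single_apply, Fin.ext_iff, triMat, Matrix.of_apply, hm, eq_comm (b := (i : ℕ))]
      by_cases h1 : (i : ℕ) = m + 1
      · simp [h1]
      · by_cases h2 : (i : ℕ) = m
        · simp [h2, show m ≠ m + 1 + 1 by omega]
        · simp [h1, h2, Ne.symm h2]

namespace RepresentedBy

variable {A B : Module.End K V} {v : ℕ → V}

theorem swap {M N : Matrix (Fin (d + 1)) (Fin (d + 1)) K} (h : RepresentedBy A B v (M, N)) :
    RepresentedBy B A v (N, M) := by
  obtain ⟨b, hb, hA, hB⟩ := h
  exact ⟨b, hb, hB, hA⟩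

theorem congr {v' : ℕ → V} {lo di up lo₁ di₁ up₁ lo' di' up' lo₁' di₁' up₁' : ℕ → K}
    (h : RepresentedBy A B v ((triMat lo di up, triMat lo₁ di₁ up₁) :
      Matrix (Fin (d + 1)) (Fin (d + 1)) K × Matrix (Fin (d + 1)) (Fin (d + 1)) K))
    (hv : ∀ n ≤ d, v n = v' n)
    (hlo : ∀ i, 1 ≤ i → i ≤ d → lo i = lo' i) (hdi : ∀ i, i ≤ d → di i = di' i)
    (hup : ∀ i, 1 ≤ i → i ≤ d → up i = up' i)
    (hlo₁ : ∀ i, 1 ≤ i → i ≤ d → lo₁ i = lo₁' i) (hdi₁ : ∀ i, i ≤ d → di₁ i = di₁' i)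
    (hup₁ : ∀ i, 1 ≤ i → i ≤ d → up₁ i = up₁' i) :
    RepresentedBy A B v' ((triMat lo' di' up', triMat lo₁' di₁' up₁') :
      Matrix (Fin (d + 1)) (Fin (d + 1)) K × Matrix (Fin (d + 1)) (Fin (d + 1)) K) := by
  rw [triMat_congr hlo hdi hup, triMat_congr hlo₁ hdi₁ hup₁] at h
  obtain ⟨b, hb, h⟩ := h
  exact ⟨b, fun i => (hb i).trans (hv i (by omega)), h⟩

theorem _root_.triMat_rev (lo di up : ℕ → K) (i j : Fin (d + 1)) :
    (triMat lo di up : Matrix (Fin (d + 1)) (Fin (d + 1)) K) i.rev j.rev =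
      (triMat (fun i => up (d - i + 1)) (fun i => di (d - i)) (fun i => lo (d - i + 1)) :
        Matrix (Fin (d + 1)) (Fin (d + 1)) K) i j := by
  have hi : ((i.rev : Fin (d + 1)) : ℕ) = d - i := by rw [Fin.val_rev]; omega
  have hj : ((j.rev : Fin (d + 1)) : ℕ) = d - j := by rw [Fin.val_rev]; omega
  simp only [triMat, Matrix.of_apply, hi, hj]
  have := Fin.is_le i
  have := Fin.is_le j
  by_cases h1 : (i : ℕ) = j + 1
  · rw [if_neg (by omega), if_neg (by omega), if_pos (by omega), if_pos h1]
    congr 1; omega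
  by_cases h2 : (i : ℕ) = j
  · rw [if_neg (by omega), if_pos (by omega), if_neg h1, if_pos h2]
  by_cases h3 : (j : ℕ) = i + 1
  · rw [if_pos (by omega), if_neg h1, if_neg h2, if_pos h3]
    congr 1; omega
  rw [if_neg (by omega), if_neg (by omega), if_neg (by omega), if_neg h1, if_neg h2, if_neg h3]

theorem rev {lo di up lo₁ di₁ up₁ : ℕ → K}
    (h : RepresentedBy A B v ((triMat lo di up, triMat lo₁ di₁ up₁) :
      Matrix (Fin (d + 1)) (Fin (d + 1)) K × Matrix (Fin (d + 1)) (Fin (d + 1)) K)) :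
    RepresentedBy A B (fun i => v (d - i))
      ((triMat (fun i => up (d - i + 1)) (fun i => di (d - i)) (fun i => lo (d - i + 1)),
        triMat (fun i => up₁ (d - i + 1)) (fun i => di₁ (d - i)) (fun i => lo₁ (d - i + 1))) :
      Matrix (Fin (d + 1)) (Fin (d + 1)) K × Matrix (Fin (d + 1)) (Fin (d + 1)) K) := by
  obtain ⟨b, hb, hA, hB⟩ := h
  have hrev : ∀ (X : Module.End K V) (i j : Fin (d + 1)),
      LinearMap.toMatrix (b.reindex Fin.revPerm) (b.reindex Fin.revPerm) X i j =
        LinearMap.toMatrix b b X i.rev j.rev := by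
    intro X i j
    simp [LinearMap.toMatrix_apply]
  refine ⟨b.reindex Fin.revPerm, fun i => ?_, ?_, ?_⟩
  · rw [Module.Basis.reindex_apply, Fin.revPerm_symm, Fin.revPerm_apply, hb, Fin.val_rev]
    congr 1; omega
  · ext i j
    rw [hrev, hA]
    exact triMat_rev _ _ _ _ _
  · ext i j
    rw [hrev, hB]
    exact triMat_rev _ _ _ _ _

end RepresentedBy

/-- The shape of the pair of matrices belonging to an ordering `wxyz` of `Ω`. -/
def HasShape (y z : Omega4)
    (M : Matrix (Fin (d + 1)) (Fin (d + 1)) K × Matrix (Fin (d + 1)) (Fin (d + 1)) K) : Prop :=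
  (¬ y.Starred → ¬ z.Starred → M.1.IsDiag ∧ IsIrredTridiagonal M.2) ∧
  (y.Starred → ¬ z.Starred → IsLowerBidiagonal M.1 ∧ IsUpperBidiagonal M.2) ∧
  (¬ y.Starred → z.Starred → IsUpperBidiagonal M.1 ∧ IsLowerBidiagonal M.2) ∧
  (y.Starred → z.Starred → IsIrredTridiagonal M.1 ∧ M.2.IsDiag)

theorem isDiag_triMat (di : ℕ → K) :
    (triMat 0 di 0 : Matrix (Fin (d + 1)) (Fin (d + 1)) K).IsDiag := by
  intro i j hij
  have : (i : ℕ) ≠ j := fun h => hij (Fin.ext h)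
  simp [triMat, this]

theorem isLowerBidiagonal_triMat (lo di : ℕ → K) :
    IsLowerBidiagonal (triMat lo di 0 : Matrix (Fin (d + 1)) (Fin (d + 1)) K) := by
  intro i j hij
  by_contra! h
  exact hij (by simp [triMat, h.1, h.2])

theorem isUpperBidiagonal_triMat (di up : ℕ → K) :
    IsUpperBidiagonal (triMat 0 di up : Matrix (Fin (d + 1)) (Fin (d + 1)) K) := by
  intro i j hij
  by_contra! h
  exact hij (by simp [triMat, h.1, h.2])

theorem isIrredTridiagonal_triMat {lo di up : ℕ → K} (hlo : ∀ i, 1 ≤ i → i ≤ d → lo i ≠ 0)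
    (hup : ∀ i, 1 ≤ i → i ≤ d → up i ≠ 0) :
    IsIrredTridiagonal (triMat lo di up : Matrix (Fin (d + 1)) (Fin (d + 1)) K) := by
  intro i j
  simp only [triMat, Matrix.of_apply]
  refine ⟨fun h => ?_, fun h => ?_⟩
  · rw [lt_abs] at h
    rw [if_neg (by omega), if_neg (by omega), if_neg (by omega)]
  · rw [abs_eq one_pos.le] at h
    split_ifs with h1 h2 h3
    · exact hlo _ (by omega) (by omega)
    · omega
    · exact hup _ (by omega) (by omega)
    · omega

theorem HasShape.lower_upper {y z : Omega4} (hy : y.Starred) (hz : ¬ z.Starred)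
    (lo di di' up : ℕ → K) : HasShape y z ((triMat lo di 0, triMat 0 di' up) :
      Matrix (Fin (d + 1)) (Fin (d + 1)) K × Matrix (Fin (d + 1)) (Fin (d + 1)) K) :=
  ⟨fun h => absurd hy h, fun _ _ => ⟨isLowerBidiagonal_triMat _ _, isUpperBidiagonal_triMat _ _⟩,
    fun h => absurd hy h, fun _ h => absurd h hz⟩

theorem HasShape.upper_lower {y z : Omega4} (hy : ¬ y.Starred) (hz : z.Starred)
    (up di di' lo : ℕ → K) : HasShape y z ((triMat 0 di up, triMat lo di' 0) :
      Matrix (Fin (d + 1)) (Fin (d + 1)) K × Matrix (Fin (d + 1)) (Fin (d + 1)) K) :=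
  ⟨fun _ h => absurd hz h, fun h => absurd h hy,
    fun _ _ => ⟨isUpperBidiagonal_triMat _ _, isLowerBidiagonal_triMat _ _⟩,
    fun h => absurd h hy⟩

theorem HasShape.diag_tridiag {y z : Omega4} (hy : ¬ y.Starred) (hz : ¬ z.Starred)
    {di lo di' up : ℕ → K} (hlo : ∀ i, 1 ≤ i → i ≤ d → lo i ≠ 0)
    (hup : ∀ i, 1 ≤ i → i ≤ d → up i ≠ 0) : HasShape y z ((triMat 0 di 0, triMat lo di' up) :
      Matrix (Fin (d + 1)) (Fin (d + 1)) K × Matrix (Fin (d + 1)) (Fin (d + 1)) K) :=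
  ⟨fun _ _ => ⟨isDiag_triMat _, isIrredTridiagonal_triMat hlo hup⟩, fun h => absurd h hy,
    fun _ h => absurd h hz, fun h => absurd h hy⟩

theorem HasShape.tridiag_diag {y z : Omega4} (hy : y.Starred) (hz : z.Starred)
    {di lo di' up : ℕ → K} (hlo : ∀ i, 1 ≤ i → i ≤ d → lo i ≠ 0)
    (hup : ∀ i, 1 ≤ i → i ≤ d → up i ≠ 0) : HasShape y z ((triMat lo di' up, triMat 0 di 0) :
      Matrix (Fin (d + 1)) (Fin (d + 1)) K × Matrix (Fin (d + 1)) (Fin (d + 1)) K) :=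
  ⟨fun h => absurd hy h, fun _ h => absurd hz h, fun h => absurd hy h,
    fun _ _ => ⟨isIrredTridiagonal_triMat hlo hup, isDiag_triMat _⟩⟩

set_option maxHeartbeats 2000000 in
theorem hasShape_matrixTable {θ θs φ ψ : ℕ → K} (a as : ℕ → K)
    (hθ : ∀ i j : Fin (d + 1), θ i = θ j → i = j) (hθs : ∀ i j : Fin (d + 1), θs i = θs j → i = j)
    (hφ : ∀ i, 1 ≤ i → i ≤ d → φ i ≠ 0) (hψ : ∀ i, 1 ≤ i → i ≤ d → ψ i ≠ 0)
    {w x y z : Omega4} (hwx : w ≠ x) (hwy : w ≠ y) (hwz : w ≠ z) (hxy : x ≠ y) (hxz : x ≠ z)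
    (hyz : y ≠ z) : HasShape y z (LeonardSystem.matrixTable d θ θs a as φ ψ w x y z) := by
  have hb : ∀ i ≤ d, prodBelow θ i ≠ 0 := fun i hi => prodBelow_ne_zero hθ hi
  have hbs : ∀ i ≤ d, prodBelow θs i ≠ 0 := fun i hi => prodBelow_ne_zero hθs hi
  have ha : ∀ i ≤ d, prodAbove d θ i ≠ 0 := fun i hi => prodAbove_ne_zero hθ hi
  have has : ∀ i ≤ d, prodAbove d θs i ≠ 0 := fun i hi => prodAbove_ne_zero hθs hi
  cases w <;> cases x <;> first | exact absurd rfl hwx | skip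
  all_goals cases y <;> first | exact absurd rfl hwy | exact absurd rfl hxy | skip
  all_goals
    cases z <;> first | exact absurd rfl hwz | exact absurd rfl hxz | exact absurd rfl hyz | skip
  all_goals simp only [LeonardSystem.matrixTable]
  all_goals
    first
    | exact HasShape.lower_upper (by simp [Omega4.Starred]) (by simp [Omega4.Starred]) _ _ _ _
    | exact HasShape.upper_lower (by simp [Omega4.Starred]) (by simp [Omega4.Starred]) _ _ _ _
    | refine HasShape.diag_tridiag (by simp [Omega4.Starred]) (by simp [Omega4.Starred]) ?_ ?_
    | refine HasShape.tridiag_diag (by simp [Omega4.Starred]) (by simp [Omega4.Starred]) ?_ ?_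
  -- Only the tridiagonal cases are left; each off-diagonal entry is a split parameter times a
  -- quotient of products of eigenvalue differences.
  all_goals
    intro i h1 h2
    refine mul_ne_zero ?_ (div_ne_zero ?_ ?_)
  all_goals
    first
    | exact hφ _ (by omega) (by omega)
    | exact hψ _ (by omega) (by omega)
    | exact hb _ (by omega)
    | exact hbs _ (by omega)
    | exact ha _ (by omega)
    | exact has _ (by omega)

end LinearAlgebra

/-! ### Assembling the tables for a Leonard system. -/

namespace LeonardSystem

variable {K 𝒜 V : Type*} [Field K] [Ring 𝒜] [Algebra K 𝒜] {d : ℕ}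
  [AddCommGroup V] [Module K V] [Module 𝒜 V] [IsScalarTower K 𝒜 V]

theorem fromLow_smul (A : 𝒜) (θ : Fin (d + 1) → K) (x : V) (n : ℕ) :
    fromLow A θ n • x = lowVec (Algebra.lsmul K K V A) (seqNat θ) x n := by
  rw [lowVec_eq_aeval, aeval_algHom_apply]
  rfl

/-- The product runs over the `d - n` eigenvalues above `n`, hence the length `d - n` for the
reversed sequence. -/
theorem fromHigh_smul (A : 𝒜) (θ : Fin (d + 1) → K) (x : V) {n : ℕ} (hn : n ≤ d) :
    fromHigh A θ n • x =
      lowVec (Algebra.lsmul K K V A) (fun i => seqNat θ (d - i)) x (d - n) := by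
  rw [lowVec_eq_aeval, aeval_algHom_apply, fromHigh, Algebra.lsmul_coe]
  congr 2
  refine Finset.prod_bij' (fun n _ => d - n) (fun n _ => d - n) ?_ ?_ ?_ ?_ ?_
  · intro k hk; simp only [Finset.mem_range, Finset.mem_Ioc] at *; omega
  · intro k hk; simp only [Finset.mem_range, Finset.mem_Ioc] at *; omega
  · intro k hk; simp only [Finset.mem_Ioc] at *; omega
  · intro k hk; simp only [Finset.mem_range] at *; omega
  · intro k hk
    rw [Nat.sub_sub_self (Finset.mem_Ioc.1 hk).2]

theorem fromHigh_sub_smul (A : 𝒜) (θ : Fin (d + 1) → K) (x : V) {n : ℕ} (hn : n ≤ d) :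
    fromHigh A θ (d - n) • x =
      lowVec (Algebra.lsmul K K V A) (fun i => seqNat θ (d - i)) x n := by
  rw [fromHigh_smul A θ x (Nat.sub_le d n), Nat.sub_sub_self hn]

theorem _root_.IsEigenbasis.representedBy {A : 𝒜} {θ : Fin (d + 1) → K} {E : Fin (d + 1) → 𝒜}
    {e : Module.Basis (Fin (d + 1)) K V} (he : IsEigenbasis A θ E e)
    (hθ : Function.Injective θ) {Y : Module.End K V} {ζ ζ' φ ψ : ℕ → K} {x : V}
    (h : IsSplitBasis d (Algebra.lsmul K K V A) Y (seqNat θ) ζ φ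
      (lowVec (Algebra.lsmul K K V A) (seqNat θ) x))
    (h' : IsSplitBasis d (Algebra.lsmul K K V A) Y (fun i => seqNat θ (d - i)) ζ' ψ
      (lowVec (Algebra.lsmul K K V A) (fun i => seqNat θ (d - i)) x))
    (hY : IsIrredTridiagonal (LinearMap.toMatrix e e Y)) {a : ℕ → K}
    (ha : ∀ i : Fin (d + 1), LinearMap.toMatrix e e Y i i = a i) :
    RepresentedBy (Algebra.lsmul K K V A) Y (fun n => seqNat E n • x)
      ((triMat 0 (seqNat θ) 0,
        triMat (fun i => ψ (d - i + 1) *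
            (prodAbove d (seqNat θ) i / prodAbove d (seqNat θ) (i - 1))) a
          (fun i => φ i * (prodBelow (seqNat θ) (i - 1) / prodBelow (seqNat θ) i))) :
      Matrix (Fin (d + 1)) (Fin (d + 1)) K × Matrix (Fin (d + 1)) (Fin (d + 1)) K) := by
  obtain ⟨g, hg, h1, h2⟩ := exists_basis_of_isSplitBasis h h' e
    (fun i => by rw [seqNat_coe]; exact he.smul_eq i)
    (fun i j hij => hθ (by rwa [seqNat_coe, seqNat_coe] at hij)) hY ha
  exact ⟨g, fun i => by
    change g i = seqNat E i • x
    rw [hg, seqNat_coe, he.proj_smul], h1, h2⟩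

theorem representedBy_matrixTable [IsSimpleModule 𝒜 V]
    (σ : 𝒜 ≃ₐ[K] Matrix (Fin (d + 1)) (Fin (d + 1)) K)
    (Φ : LeonardSystem K 𝒜 d) (η : Omega4 → V) (hη : ∀ w, η w ≠ 0)
    (h0 : η .z0 ∈ image (K := K) V (Φ.E 0))
    (hd : η .zd ∈ image (K := K) V (Φ.E (Fin.last d)))
    (hs0 : η .s0 ∈ image (K := K) V (Φ.Es 0))
    (hsd : η .sd ∈ image (K := K) V (Φ.Es (Fin.last d)))
    {w x y z : Omega4} (hwx : w ≠ x) (hwy : w ≠ y) (hwz : w ≠ z) (hxy : x ≠ y) (hxz : x ≠ z)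
    (hyz : y ≠ z) :
    RepresentedBy (Algebra.lsmul K K V Φ.A) (Algebra.lsmul K K V Φ.As)
        (Φ.basisVec η w x y z) (matrixTable d (seqNat Φ.θ) (seqNat Φ.θs) (Φ.a σ) (Φ.as σ)
          (Φ.firstSplit V) (Φ.secondSplit V) w x y z) ∧
      HasShape y z (matrixTable d (seqNat Φ.θ) (seqNat Φ.θs) (Φ.a σ) (Φ.as σ)
          (Φ.firstSplit V) (Φ.secondSplit V) w x y z) := by
  have hinj := lsmul_injective (V := V) σ
  have hV := finrank_eq_of_algEquiv (V := V) σ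
  obtain ⟨e, he⟩ := Φ.primA.exists_isEigenbasis hV hinj
  obtain ⟨f, hf⟩ := Φ.primAs.exists_isEigenbasis hV hinj
  have hLP := Φ.isLeonardPair hinj he hf
  obtain ⟨Q, hQ, hQA, hQB⟩ := hLP.exists_form
  have key : ∀ {A : 𝒜} {θ : Fin (d + 1) → K} {E : Fin (d + 1) → 𝒜}
      {b : Module.Basis (Fin (d + 1)) K V}, IsEigenbasis A θ E b → Function.Injective θ →
      ∀ {u : V} (i : Fin (d + 1)), u ≠ 0 → u ∈ image (K := K) V (E i) →
        IsSimpleEigenvector (Algebra.lsmul K K V A) (seqNat θ i) u := by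
    intro A θ E b hb hθ u i hu hi
    obtain ⟨c, rfl⟩ := hb.mem_image_iff.1 hi
    exact IsSimpleEigenvector.of_eigenbasis (ξ := seqNat θ)
      (fun i => by rw [seqNat_coe]; exact hb.smul_eq i)
      (fun i j hij => hθ (by rwa [seqNat_coe, seqNat_coe] at hij)) (left_ne_zero_of_smul hu)
  have k0 := key he Φ.primA.injective 0 (hη _) h0
  have kd := key he Φ.primA.injective (Fin.last d) (hη _) hd
  have ks0 := key hf Φ.primAs.injective 0 (hη _) hs0
  have ksd := key hf Φ.primAs.injective (Fin.last d) (hη _) hsd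
  simp only [Fin.val_zero, Fin.val_last] at k0 kd ks0 ksd
  have hφ := Φ.isSplitBasis hinj he hf
  have hψ : IsSplitBasis d (Algebra.lsmul K K V Φ.A) (Algebra.lsmul K K V Φ.As)
      (fun i => seqNat Φ.θ (d - i)) (seqNat Φ.θs) (Φ.secondSplit V) _ :=
    (Φ.secondInversion.isSplitBasis hinj he.rev hf).congr
      (fun i hi => seqNat_rev Φ.θ hi) (fun _ _ => rfl) (fun _ _ => rfl)
  have hφ0 : ∀ i, 1 ≤ i → i ≤ d → Φ.firstSplit V i ≠ 0 := by
    intro i h1 h2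
    obtain ⟨j, rfl⟩ : ∃ j, i = j + 1 := ⟨i - 1, by omega⟩
    exact hφ.ne_zero j h2
  have hψ0 : ∀ i, 1 ≤ i → i ≤ d → Φ.secondSplit V i ≠ 0 := by
    intro i h1 h2
    obtain ⟨j, rfl⟩ : ∃ j, i = j + 1 := ⟨i - 1, by omega⟩
    exact hψ.ne_zero j h2
  refine ⟨?_, hasShape_matrixTable _ _ hLP.injA hLP.injB hφ0 hψ0 hwx hwy hwz hxy hxz hyz⟩
  obtain ⟨S1, S2, S3, S4⟩ := hφ.exists_relatives hV hQ hQA hQB k0 kd ks0 ksd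
  -- The second inversion reverses the eigenvalues of `A`, so `η_d` and `η_0` exchange roles.
  obtain ⟨S5, S6', S7', S8⟩ := hψ.exists_relatives hV hQ hQA hQB (x₀ := η .zd) (x₁ := η .z0)
    (by simpa using kd) (by simpa using k0) ks0 ksd
  have S6 := S6'.congr (ξ' := fun i => seqNat Φ.θs (d - i)) (fun _ _ => rfl) (ζ' := seqNat Φ.θ)
    (φ' := fun i => Φ.secondSplit V (d - i + 1))
    (fun i hi => by simp only [Nat.sub_sub_self hi]) (fun _ _ => rfl)
  -- `congr` leaves the vectors written with the doubly reversed sequence, which agrees with `seqNat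
  -- Φ.θ` only up to index `d`; `normalize` rewrites them.
  have S7 := (S7'.congr (ξ' := seqNat Φ.θ) (ζ' := fun i => seqNat Φ.θs (d - i))
    (φ' := fun i => Φ.secondSplit V (d - i + 1)) (fun i hi => by simp only [Nat.sub_sub_self hi])
    (fun _ _ => rfl) (fun _ _ => rfl)).normalize (by simpa using ksd)
  have hYe : ∀ i : Fin (d + 1),
      LinearMap.toMatrix e e (Algebra.lsmul K K V Φ.As) i i = Φ.as σ i := fun i => by
    rw [he.trace_mul_eq σ, LeonardSystem.as, seqNat_coe]
  have hYf : ∀ i : Fin (d + 1),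
      LinearMap.toMatrix f f (Algebra.lsmul K K V Φ.A) i i = Φ.a σ i := fun i => by
    rw [hf.trace_mul_eq σ, LeonardSystem.a, seqNat_coe]
  have R1 := S1.representedBy hV
  have R2 := (S2.representedBy hV).swap
  have R3 := S3.representedBy hV
  have R4 := (S4.representedBy hV).swap
  have R5 := S5.representedBy hV
  have R6 := (S6.representedBy hV).swap
  have R7 := S7.representedBy hV
  have R8 := (S8.representedBy hV).swap
  -- The split bases are paired by starting vector: `S1`, `S5` at `η*_0`; `S7`, `S3` at `η*_d`;
  -- `S4`, `S6` at `η_0`; `S8`, `S2` at `η_d`. Within each pair the eigenvalues occur in opposite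
  -- orders.
  have D1 := he.representedBy Φ.primA.injective S1 S5 hLP.tridiagB hYe
  have D2 := he.representedBy Φ.primA.injective S7 S3 hLP.tridiagB hYe
  have D3 := (hf.representedBy Φ.primAs.injective S4 S6 hLP.tridiagA hYf).swap
  have D4 := (hf.representedBy Φ.primAs.injective S8 S2 hLP.tridiagA hYf).swap
  -- Interchanging the last two symbols of `wxyz` reverses the basis, so the 24 orderings are the
  -- twelve representations above and their reversals.
  cases w <;> cases x <;> first | exact absurd rfl hwx | skip
  all_goals cases y <;> first | exact absurd rfl hwy | exact absurd rfl hxy | skip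
  all_goals
    cases z <;> first | exact absurd rfl hwz | exact absurd rfl hxz | exact absurd rfl hyz | skip
  all_goals simp only [matrixTable]
  · refine D4.congr (fun _ _ => rfl) ?_ ?_ ?_ ?_ ?_ ?_ <;> intro i <;> intros <;>
      first | rfl | (congr! <;> omega)
  · refine D4.rev.congr (fun _ _ => rfl) ?_ ?_ ?_ ?_ ?_ ?_ <;> intro i <;> intros <;>
      first | rfl | (simp only [Nat.add_sub_cancel]; congr! <;> omega)
  · refine R8.congr (fun n _ => (fromLow_smul _ _ _ _).symm) ?_ ?_ ?_ ?_ ?_ ?_ <;> intro i <;> intros <;>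
      rfl
  · refine R8.rev.congr (fun n _ => (fromLow_smul _ _ _ _).symm) ?_ ?_ ?_ ?_ ?_ ?_ <;> intro i <;> intros <;>
      first | rfl | (congr! <;> omega)
  · refine R2.congr (fun n hn => (fromHigh_sub_smul _ _ _ hn).symm) ?_ ?_ ?_ ?_ ?_ ?_ <;> intro i <;> intros <;>
      rfl
  · refine R2.rev.congr (fun n hn => (fromHigh_smul _ _ _ hn).symm) ?_ ?_ ?_ ?_ ?_ ?_ <;> intro i <;> intros <;>
      first | rfl | (congr! <;> omega)
  · refine D3.congr (fun _ _ => rfl) ?_ ?_ ?_ ?_ ?_ ?_ <;> intro i <;> intros <;>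
      first | rfl | (congr! <;> omega)
  · refine D3.rev.congr (fun _ _ => rfl) ?_ ?_ ?_ ?_ ?_ ?_ <;> intro i <;> intros <;>
      first | rfl | (simp only [Nat.add_sub_cancel]; congr! <;> omega)
  · refine R4.congr (fun n _ => (fromLow_smul _ _ _ _).symm) ?_ ?_ ?_ ?_ ?_ ?_ <;> intro i <;> intros <;>
      rfl
  · refine R4.rev.congr (fun n _ => (fromLow_smul _ _ _ _).symm) ?_ ?_ ?_ ?_ ?_ ?_ <;> intro i <;> intros <;>
      rfl
  · refine R6.congr (fun n hn => (fromHigh_sub_smul _ _ _ hn).symm) ?_ ?_ ?_ ?_ ?_ ?_ <;> intro i <;> intros <;>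
      rfl
  · refine R6.rev.congr (fun n hn => (fromHigh_smul _ _ _ hn).symm) ?_ ?_ ?_ ?_ ?_ ?_ <;> intro i <;> intros <;>
      first | rfl | (congr! <;> omega)
  · refine R7.rev.congr (fun n _ => (fromLow_smul _ _ _ _).symm) ?_ ?_ ?_ ?_ ?_ ?_ <;> intro i <;> intros <;>
      first | rfl | (congr! <;> omega)
  · refine R7.congr (fun n _ => (fromLow_smul _ _ _ _).symm) ?_ ?_ ?_ ?_ ?_ ?_ <;> intro i <;> intros <;>
      rfl
  · refine R3.rev.congr (fun n hn => (fromHigh_smul _ _ _ hn).symm) ?_ ?_ ?_ ?_ ?_ ?_ <;> intro i <;> intros <;>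
      first | rfl | (congr! <;> omega)
  · refine R3.congr (fun n hn => (fromHigh_sub_smul _ _ _ hn).symm) ?_ ?_ ?_ ?_ ?_ ?_ <;> intro i <;> intros <;>
      rfl
  · refine D2.congr (fun _ _ => rfl) ?_ ?_ ?_ ?_ ?_ ?_ <;> intro i <;> intros <;>
      first | rfl | (congr! <;> omega)
  · refine D2.rev.congr (fun _ _ => rfl) ?_ ?_ ?_ ?_ ?_ ?_ <;> intro i <;> intros <;>
      first | rfl | (simp only [Nat.add_sub_cancel]; congr! <;> omega)
  · refine R1.rev.congr (fun n _ => (fromLow_smul _ _ _ _).symm) ?_ ?_ ?_ ?_ ?_ ?_ <;> intro i <;> intros <;>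
      rfl
  · refine R1.congr (fun n _ => (fromLow_smul _ _ _ _).symm) ?_ ?_ ?_ ?_ ?_ ?_ <;> intro i <;> intros <;>
      rfl
  · refine R5.rev.congr (fun n hn => (fromHigh_smul _ _ _ hn).symm) ?_ ?_ ?_ ?_ ?_ ?_ <;> intro i <;> intros <;>
      first | rfl | (congr! <;> omega)
  · refine R5.congr (fun n hn => (fromHigh_sub_smul _ _ _ hn).symm) ?_ ?_ ?_ ?_ ?_ ?_ <;> intro i <;> intros <;>
      rfl
  · refine D1.congr (fun _ _ => rfl) ?_ ?_ ?_ ?_ ?_ ?_ <;> intro i <;> intros <;>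
      rfl
  · refine D1.rev.congr (fun _ _ => rfl) ?_ ?_ ?_ ?_ ?_ ?_ <;> intro i <;> intros <;>
      first | rfl | (simp only [Nat.add_sub_cancel]; congr! <;> omega)

end LeonardSystem

end

theorem theorem11p2 {K 𝒜 V : Type*} [Field K] [Ring 𝒜] [Algebra K 𝒜] (d : ℕ)
    (σ : 𝒜 ≃ₐ[K] Matrix (Fin (d + 1)) (Fin (d + 1)) K)
    [AddCommGroup V] [Module K V] [Module 𝒜 V] [IsScalarTower K 𝒜 V] [IsSimpleModule 𝒜 V]
    (Φ : LeonardSystem K 𝒜 d) (η : Omega4 → V) (hη : ∀ w, η w ≠ 0)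
    (h0 : η .z0 ∈ LeonardSystem.image (K := K) V (Φ.E 0))
    (hd : η .zd ∈ LeonardSystem.image (K := K) V (Φ.E (Fin.last d)))
    (hs0 : η .s0 ∈ LeonardSystem.image (K := K) V (Φ.Es 0))
    (hsd : η .sd ∈ LeonardSystem.image (K := K) V (Φ.Es (Fin.last d)))
    (g : Fin 4 ≃ Omega4) :
    ∃ b : Module.Basis (Fin (d + 1)) K V,
      (∀ i, b i = Φ.basisVec η (g 0) (g 1) (g 2) (g 3) i) ∧
      ∃ Ag Asg : Matrix (Fin (d + 1)) (Fin (d + 1)) K,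
        Ag = LinearMap.toMatrix b b (Algebra.lsmul K K V Φ.A) ∧
        Asg = LinearMap.toMatrix b b (Algebra.lsmul K K V Φ.As) ∧
        (Ag, Asg) = LeonardSystem.matrixTable d (seqNat Φ.θ) (seqNat Φ.θs) (Φ.a σ) (Φ.as σ)
          (Φ.firstSplit V) (Φ.secondSplit V) (g 0) (g 1) (g 2) (g 3) ∧
        (¬ (g 2).Starred → ¬ (g 3).Starred → Ag.IsDiag ∧ IsIrredTridiagonal Asg) ∧
        ((g 2).Starred → ¬ (g 3).Starred → IsLowerBidiagonal Ag ∧ IsUpperBidiagonal Asg) ∧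
        (¬ (g 2).Starred → (g 3).Starred → IsUpperBidiagonal Ag ∧ IsLowerBidiagonal Asg) ∧
        ((g 2).Starred → (g 3).Starred → IsIrredTridiagonal Ag ∧ Asg.IsDiag) := by
  have hne : ∀ {i j : Fin 4}, i ≠ j → g i ≠ g j := fun hij h => hij (g.injective h)
  obtain ⟨⟨b, hb, hA, hAs⟩, hshape⟩ := LeonardSystem.representedBy_matrixTable σ Φ η hη h0 hd hs0 hsd
    (w := g 0) (x := g 1) (y := g 2) (z := g 3) (hne (by decide)) (hne (by decide))
    (hne (by decide)) (hne (by decide)) (hne (by decide)) (hne (by decide))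
  refine ⟨b, hb, _, _, rfl, rfl, Prod.ext hA hAs, ?_⟩
  rw [hA, hAs]
  exact hshape
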